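/- Let $\mathcal H$ be a complex Hilbert space (inner products are linear in the first argument). Let $\mathfrak A(\mathcal H)$ be the CAR algebra, i.e. the universal unital $C^*$-algebra generated by elements $a(h)$, $h\in\mathcal H$, such that $h\mapsto a^*(h):=a(h)^*$ is linear and $$a(h)a(k)+a(k)a(h)=0,\qquad a^*(h)a(k)+a(k)a^*(h)=\langle h,k\rangle 1 .$$ For a unitary $U$ on $\mathcal H$ let $\gamma_U$ be the $*$-automorphism of $\mathfrak A(\mathcal H)$ with $\gamma_U(a(h))=a(Uh)$, and let $\mathfrak I(\mathcal H)=\{x\in\mathfrak A(\mathcal H):\gamma_{\lambda 1}(x)=x\text{ for all }|\lambda|=1\}$ be the gauge-invariant CAR algebra; each $\gamma_U$ maps $\mathfrak I(\mathcal H)$ onto itself. Let $K$ be a bounded operator on $\mathcal H$ with $0\le K\le 1$, let $\varphi_K$ be the quasi-free state on $\mathfrak A(\mathcal H)$ with symbol $K$, i.e. the state with $$\varphi_K(a^*(h_n)\cdots a^*(h_1)a(k_1)\cdots a(k_m))=\delta_{n,m}\det[\langle Kh_i,k_j\rangle]_{i,j=1}^n\qquad(n,m\ge 0),$$ and let $(\rho_K,\mathcal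 H_K,\Omega_K)$ be a GNS triple of $\varphi_K|_{\mathfrak I(\mathcal H)}$: a unital $*$-representation $\rho_K$ of $\mathfrak I(\mathcal H)$ on a Hilbert space $\mathcal H_K$ and a vector $\Omega_K\in\mathcal H_K$ such that $\rho_K(\mathfrak I(\mathcal H))\Omega_K$ is dense and $\langle\rho_K(x)\Omega_K,\Omega_K\rangle=\varphi_K(x)$ for all $x\in\mathfrak I(\mathcal H)$. Let $A$ be a (possibly unbounded) self-adjoint operator on $\mathcal H$ that commutes with $K$ (that is, $K\,\mathrm{dom}(A)\subset\mathrm{dom}(A)$ and $AKx=KAx$ for $x\in\mathrm{dom}(A)$), and let $(U_t)_{t\in\mathbb R}$, $U_t=e^{\mathrm itA}$, be the strongly continuous one-parameter unitary group generated by $A$. Then: 1. There is a unique strongly continuous one-parameter group $(\Gamma_K(U_t))_{t\in\mathbb R}$ of unitary operators on $\mathcal H_K$ such that $\Gamma_K(U_t)\rho_K(x)\Omega_K=\rho_K(\gamma_{U_t}(x))\Omega_K$ for all $t\in\mathbb R$ and $x\in\mathfrak I(\mathcal H)$. 2. Let $d\Gamma_K(A)$ be the infinitesimal generator of $(\Gamma_K(U_t))_{t\in\mathbb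 R}$, normalised by $\Gamma_K(U_t)=e^{\mathrm it\,d\Gamma_K(A)}$. If $\mathcal V$ is a dense linear subspace of $\mathcal H$ with $\mathcal V\subset\mathrm{dom}(A)$ and $U_t\mathcal V\subset\mathcal V$ for all $t\in\mathbb R$, then $$\widetilde{\mathcal V}:=\mathrm{span}\{\rho_K(a^*(h_1)\cdots a^*(h_n)a(k_1)\cdots a(k_n))\Omega_K : n\ge 0,\ h_1,\dots,h_n,k_1,\dots,k_n\in\mathcal V\}$$ is a core for $d\Gamma_K(A)$, i.e. it is contained in $\mathrm{dom}(d\Gamma_K(A))$ and the closure of the restriction of $d\Gamma_K(A)$ to it is $d\Gamma_K(A)$. -/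

import Mathlib

open scoped ENNReal ComplexOrder

noncomputable section

universe u

namespace GICAR

/-! ### Strongly continuous one-parameter unitary groups and their generators -/

/-- A strongly continuous one-parameter group of unitary operators on `E`. -/
@[ext]
structure UnitaryGroup (E : Type*) [NormedAddCommGroup E] [InnerProductSpace ℂ E] where
  toFun : ℝ → (E ≃ₗᵢ[ℂ] E)
  map_zero' : ∀ x, toFun 0 x = x
  map_add' : ∀ s t x, toFun (s + t) x = toFun s (toFun t x)
  continuous' : ∀ x, Continuous fun t => toFun t x

namespace UnitaryGroup

variable {E : Type*} [NormedAddCommGroup E] [InnerProductSpace ℂ E]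

instance : CoeFun (UnitaryGroup E) fun _ => ℝ → (E ≃ₗᵢ[ℂ] E) := ⟨UnitaryGroup.toFun⟩

/-- The infinitesimal generator `B` of `U`, normalised so that `U t = exp (i t B)`: its domain
consists of those `x` for which `t ↦ U t x` is differentiable at `0`, and
`B x = -i (d/dt) U t x` at `t = 0`. -/
def generator (U : UnitaryGroup E) : E →ₗ.[ℂ] E where
  domain :=
    { carrier := {x | DifferentiableAt ℝ (fun t : ℝ => U t x) 0}
      zero_mem' := by simp
      add_mem' := fun {x y} hx hy => by
        have h : DifferentiableAt ℝ (fun t : ℝ => U t x + U t y) 0 := DifferentiableAt.fun_add hx hy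
        simp only [← map_add] at h
        exact h
      smul_mem' := fun c x hx => by
        have h : DifferentiableAt ℝ (fun t : ℝ => c • U t x) 0 := DifferentiableAt.fun_const_smul hx c
        simp only [← map_smul] at h
        exact h }
  toFun :=
    { toFun := fun x => (-Complex.I) • deriv (fun t : ℝ => U t (x : E)) 0
      map_add' := fun x y => by
        have h := deriv_fun_add (𝕜 := ℝ) (show DifferentiableAt ℝ (fun t : ℝ => U t x) 0 from x.2)
          (show DifferentiableAt ℝ (fun t : ℝ => U t y) 0 from y.2)
        simp only [← map_add] at h
        rw [← smul_add, ← h]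
        rfl
      map_smul' := fun c x => by
        have h := deriv_fun_const_smul (𝕜 := ℝ) c
          (show DifferentiableAt ℝ (fun t : ℝ => U t x) 0 from x.2)
        simp only [← map_smul] at h
        rw [RingHom.id_apply, smul_comm c, ← h]
        rfl }

end UnitaryGroup

/-! ### The CAR algebra -/

section CAR

/-- In a `C*`-algebra, `x* x + x x* = r²` implies `‖x‖ ≤ r`. -/
theorem norm_le_of_anticomm {A : Type*} [CStarAlgebra A] [Nontrivial A] {x : A} {r : ℝ}
    (hr : 0 ≤ r) (e : star x * x + x * star x = ((r : ℂ) ^ 2) • (1 : A)) : ‖x‖ ≤ r := by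
  let _ := CStarAlgebra.spectralOrder A
  let _ := CStarAlgebra.spectralOrderedRing A
  have h1 : star x * x ≤ algebraMap ℝ A (r ^ 2) := by
    have e2 : algebraMap ℝ A (r ^ 2) = star x * x + x * star x := by
      rw [e, Algebra.algebraMap_eq_smul_one]
      norm_cast
    rw [e2]
    exact le_add_of_nonneg_right (mul_star_self_nonneg _)
  have h2 := CStarAlgebra.norm_le_norm_of_nonneg_of_le (star_mul_self_nonneg x) h1
  rw [CStarRing.norm_star_mul_self, norm_algebraMap', Real.norm_of_nonneg (by positivity),
    ← sq] at h2
  exact le_of_sq_le_sq h2 hr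

variable (H : Type u) [NormedAddCommGroup H] [InnerProductSpace ℂ H]

/-- A representation of the canonical anticommutation relations over `H` in a nonzero unital
`C*`-algebra. Mathlib's inner product is linear in the second argument, so the inner product of
`h` and `k` that is linear in `h` is `inner ℂ k h`. -/
structure CARRep where
  carrier : Type u
  [cstar : CStarAlgebra carrier]
  [nontriv : Nontrivial carrier]
  ann : H →ₗ⋆[ℂ] carrier
  ann_mul_ann : ∀ h k, ann h * ann k + ann k * ann h = 0
  star_ann_mul_ann : ∀ h k,
    star (ann h) * ann k + ann k * star (ann h) = (inner ℂ k h : ℂ) • (1 : carrier)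

attribute [instance] CARRep.cstar CARRep.nontriv

variable {H}

/-- The relations bound the annihilation operators. -/
theorem CARRep.norm_ann_le (π : CARRep H) (h : H) : ‖π.ann h‖ ≤ ‖h‖ := by
  refine norm_le_of_anticomm (norm_nonneg _) ?_
  rw [π.star_ann_mul_ann, inner_self_eq_norm_sq_to_K]
  rfl

variable (H)

/-- The bounded families indexed by all representations of the relations. -/
abbrev CARProduct : Type (u + 1) := lp (fun π : CARRep H => π.carrier) ∞

instance : CStarAlgebra (CARProduct H) where

variable {H}

/-- The direct sum of all representations. -/
def annProd (h : H) : CARProduct H :=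
  ⟨fun π => π.ann h, memℓp_infty ⟨‖h‖, by rintro _ ⟨π, rfl⟩; exact π.norm_ann_le h⟩⟩

variable (H)

/-- The CAR algebra over `H`: the universal unital `C*`-algebra generated by the annihilation
operators, i.e. the `C*`-algebra generated by the direct sum of all representations of the
relations. -/
def carSubalgebra : StarSubalgebra ℂ (CARProduct H) :=
  (StarAlgebra.adjoin ℂ (Set.range (annProd (H := H)))).topologicalClosure

instance : IsClosed (carSubalgebra H : Set (CARProduct H)) :=
  StarSubalgebra.isClosed_topologicalClosure _

/-- The CAR algebra over `H`. -/
abbrev CAR : Type (u + 1) := carSubalgebra H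

variable {H}

/-- The annihilation operator `a(h)`; the creation operator `a*(h)` is `star (a h)`. -/
def a (h : H) : CAR H :=
  ⟨annProd h, StarSubalgebra.le_topologicalClosure _ (StarAlgebra.subset_adjoin ℂ _ ⟨h, rfl⟩)⟩

theorem a_mul_a (h k : H) : a h * a k + a k * a h = 0 := by
  ext π
  exact π.ann_mul_ann h k

theorem star_a_mul_a (h k : H) :
    star (a h) * a k + a k * star (a h) = (inner ℂ k h : ℂ) • (1 : CAR H) := by
  ext π
  exact π.star_ann_mul_ann h k

theorem a_smul (c : ℂ) (h : H) : a (c • h) = star c • a h := by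
  ext π
  exact π.ann.map_smulₛₗ c h

/-- The universal property: the homomorphism out of the CAR algebra given by a representation. -/
def CAR.lift (π : CARRep H) : CAR H →⋆ₐ[ℂ] π.carrier where
  toFun x := (x : CARProduct H) π
  map_one' := rfl
  map_mul' _ _ := rfl
  map_zero' := rfl
  map_add' _ _ := rfl
  commutes' _ := rfl
  map_star' _ := rfl

theorem CAR.lift_a (π : CARRep H) (h : H) : CAR.lift π (a h) = π.ann h := rfl

/-! ### Bogoliubov automorphisms and the gauge-invariant algebra -/

/-- Composition of a representation with a unitary of the one-particle space. -/
def CARRep.comp (π : CARRep H) (U : H ≃ₗᵢ[ℂ] H) : CARRep H where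
  carrier := π.carrier
  ann := π.ann ∘ₛₗ (U.toLinearEquiv : H →ₗ[ℂ] H)
  ann_mul_ann h k := π.ann_mul_ann _ _
  star_ann_mul_ann h k := by
    simpa using π.star_ann_mul_ann (U h) (U k)

/-- The action of a unitary on bounded families, by permuting the representations. -/
def bogoliubovProd (U : H ≃ₗᵢ[ℂ] H) : CARProduct H →⋆ₐ[ℂ] CARProduct H where
  toFun x := ⟨fun π => (x (π.comp U) : π.carrier), memℓp_infty ⟨‖x‖, by
    rintro _ ⟨π, rfl⟩
    exact lp.norm_apply_le_norm ENNReal.top_ne_zero x (π.comp U)⟩⟩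
  map_one' := rfl
  map_mul' _ _ := rfl
  map_zero' := rfl
  map_add' _ _ := rfl
  commutes' _ := rfl
  map_star' _ := rfl

theorem bogoliubovProd_mem (U : H ≃ₗᵢ[ℂ] H) (x : CAR H) :
    bogoliubovProd U x ∈ carSubalgebra H := by
  have hc : Continuous (bogoliubovProd U) := 
    AddMonoidHomClass.continuous_of_bound (bogoliubovProd U) 1 fun x => by
      rw [one_mul]
      exact lp.norm_le_of_forall_le (norm_nonneg x) fun π =>
        lp.norm_apply_le_norm ENNReal.top_ne_zero x (π.comp U)
  have h : carSubalgebra H ≤ (carSubalgebra H).comap (bogoliubovProd U) := by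
    refine StarSubalgebra.topologicalClosure_minimal (StarAlgebra.adjoin_le ?_) ?_
    · rintro _ ⟨h, rfl⟩
      exact (a (U h)).2
    · exact IsClosed.preimage hc (StarSubalgebra.isClosed_topologicalClosure _)
  exact h x.2

/-- The Bogoliubov transform `γ_U`. -/
def bogoliubovHom (U : H ≃ₗᵢ[ℂ] H) : CAR H →⋆ₐ[ℂ] CAR H :=
  ((bogoliubovProd U).comp (carSubalgebra H).subtype).codRestrict _ (bogoliubovProd_mem U)

theorem bogoliubovHom_a (U : H ≃ₗᵢ[ℂ] H) (h : H) : bogoliubovHom U (a h) = a (U h) := rfl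

theorem bogoliubovHom_comp (U W : H ≃ₗᵢ[ℂ] H) (x : CAR H) :
    bogoliubovHom U (bogoliubovHom W x) = bogoliubovHom (W.trans U) x := rfl

/-- Multiplication by a complex number of modulus one. -/
def phase (z : Circle) : H ≃ₗᵢ[ℂ] H where
  toLinearEquiv := LinearEquiv.smulOfNeZero ℂ H (z : ℂ) z.coe_ne_zero
  norm_map' x := by
    change ‖(z : ℂ) • x‖ = ‖x‖
    rw [norm_smul, Circle.norm_coe, one_mul]

variable (H)

/-- The GICAR algebra: the fixed points of the gauge action. -/
def gicar : StarSubalgebra ℂ (CAR H) where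
  carrier := {x | ∀ z : Circle, bogoliubovHom (phase z) x = x}
  mul_mem' hx hy z := by rw [map_mul, hx z, hy z]
  add_mem' hx hy z := by rw [map_add, hx z, hy z]
  algebraMap_mem' r z := AlgHomClass.commutes (bogoliubovHom (phase z)) r
  star_mem' hx z := by rw [map_star, hx z]

variable {H}

theorem mem_gicar {x : CAR H} :
    x ∈ gicar H ↔ ∀ z : Circle, bogoliubovHom (phase z) x = x := Iff.rfl

/-- The Bogoliubov transform `γ_U` on the GICAR algebra. -/
def bogoliubov (U : H ≃ₗᵢ[ℂ] H) : gicar H →⋆ₐ[ℂ] gicar H :=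
  ((bogoliubovHom U).comp (gicar H).subtype).codRestrict _ fun x z => by
    have h : (phase z).trans U = U.trans (phase z) := by
      ext y
      exact (map_smul U (z : ℂ) y).symm ▸ rfl
    change bogoliubovHom (phase z) (bogoliubovHom U x) = bogoliubovHom U x
    rw [bogoliubovHom_comp, ← h, ← bogoliubovHom_comp, x.2 z]

/-- `a*(h_1) ⋯ a*(h_n) a(k_1) ⋯ a(k_m)` -/
def monomial {n m : ℕ} (h : Fin n → H) (k : Fin m → H) : CAR H :=
  (List.ofFn fun i => star (a (h i))).prod * (List.ofFn fun i => a (k i)).prod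

theorem bogoliubovHom_monomial (U : H ≃ₗᵢ[ℂ] H) {n m : ℕ} (h : Fin n → H) (k : Fin m → H) :
    bogoliubovHom U (monomial h k) = monomial (U ∘ h) (U ∘ k) := by
  simp only [monomial, map_mul, map_list_prod, List.map_ofFn, Function.comp_def, map_star,
    bogoliubovHom_a]

theorem prod_ofFn_smul {A : Type*} [Ring A] [Algebra ℂ A] (c : ℂ) {n : ℕ} (f : Fin n → A) :
    (List.ofFn fun i => c • f i).prod = c ^ n • (List.ofFn f).prod := by
  induction n with
  | zero => simp
  | succ n ih =>
    rw [List.ofFn_succ, List.ofFn_succ, List.prod_cons, List.prod_cons, ih, smul_mul_smul_comm,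
      pow_succ']

theorem monomial_mem_gicar {n : ℕ} (h k : Fin n → H) : monomial h k ∈ gicar H := by
  intro z
  rw [bogoliubovHom_monomial]
  have e : ∀ f : Fin n → H, (phase z : H ≃ₗᵢ[ℂ] H) ∘ f = fun i => (z : ℂ) • f i := fun _ => rfl
  simp only [monomial, e, a_smul, star_smul, star_star, prod_ofFn_smul, smul_mul_smul_comm]
  rw [← mul_pow]
  simp [Complex.mul_conj]

/-- The gauge-invariant monomial `a*(h_1) ⋯ a*(h_n) a(k_1) ⋯ a(k_n)`. -/
def gicarMonomial {n : ℕ} (h k : Fin n → H) : gicar H := ⟨monomial h k, monomial_mem_gicar h k⟩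

/-! ### Quasi-free states and GNS triples -/

/-- A state: a normalised positive linear functional. -/
structure IsState {A : Type*} [Ring A] [StarRing A] [Algebra ℂ A] (φ : A →ₗ[ℂ] ℂ) : Prop where
  map_one : φ 1 = 1
  nonneg : ∀ x, 0 ≤ φ (star x * x)

/-- `φ` is the quasi-free state with symbol `K`. -/
structure IsQuasiFree (K : H →L[ℂ] H) (φ : CAR H →ₗ[ℂ] ℂ) : Prop where
  isState : IsState φ
  eq_det : ∀ (n : ℕ) (h k : Fin n → H),
    φ (monomial (h ∘ Fin.rev) k) = Matrix.det (Matrix.of fun i j => (inner ℂ (k j) (K (h i)) : ℂ))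
  eq_zero : ∀ (n m : ℕ) (h : Fin n → H) (k : Fin m → H), n ≠ m → φ (monomial h k) = 0

end CAR

/-! ### The anti-symmetric Fock space in the occupation number basis -/

section Fock

/-- The anti-symmetric Fock space over a Hilbert space with a Hilbert basis indexed by `ι`. -/
abbrev Fock (ι : Type u) : Type u := lp (fun _ : Finset ι => ℂ) 2

/-- The weighted permutation operator `(W f) s = w s * f (e s)`. -/
def weightedPerm {S : Type u} (w : S → ℂ) (hw : ∀ s, ‖w s‖ ≤ 1) (e : S ≃ S) :
    lp (fun _ : S => ℂ) 2 →L[ℂ] lp (fun _ : S => ℂ) 2 :=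
  have hs : ∀ f : lp (fun _ : S => ℂ) 2, Summable fun s => ‖f (e s)‖ ^ 2 := fun f => by
    have h := (lp.memℓp f).summable (by norm_num)
    have h' : Summable fun s => ‖f s‖ ^ 2 := by simpa using h
    exact (e.summable_iff (f := fun s => ‖f s‖ ^ 2)).2 h'
  have hle : ∀ (f : lp (fun _ : S => ℂ) 2) s, ‖w s * f (e s)‖ ^ 2 ≤ ‖f (e s)‖ ^ 2 := fun f s => by
    rw [norm_mul, mul_pow]
    exact mul_le_of_le_one_left (by positivity) (pow_le_one₀ (norm_nonneg _) (hw s))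
  LinearMap.mkContinuous
    { toFun := fun f => ⟨fun s => w s * f (e s), memℓp_gen (by
        simpa using Summable.of_nonneg_of_le (fun s => by positivity) (hle f) (hs f))⟩
      map_add' := fun f g => by
        ext s
        exact mul_add _ _ _
      map_smul' := fun c f => by
        ext s
        exact mul_left_comm _ _ _ } 1 fun f => by
    rw [one_mul]
    refine lp.norm_le_of_tsum_le (by norm_num) (norm_nonneg f) ?_
    have h2 := lp.norm_rpow_eq_tsum (p := 2) (by norm_num) f
    simp only [ENNReal.toReal_ofNat, Real.rpow_ofNat] at h2 ⊢
    rw [h2, ← e.tsum_eq fun s => ‖f s‖ ^ 2]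
    exact Summable.tsum_le_tsum (hle f)
      (Summable.of_nonneg_of_le (fun s => by positivity) (hle f) (hs f)) (hs f)

theorem weightedPerm_apply {S : Type u} (w : S → ℂ) (hw : ∀ s, ‖w s‖ ≤ 1) (e : S ≃ S)
    (f : lp (fun _ : S => ℂ) 2) (s : S) : weightedPerm w hw e f s = w s * f (e s) := rfl

variable {ι : Type u} [LinearOrder ι]

/-- The sign picked up by exchanging the modes `i` and `j`. -/
def tau (i j : ι) : ℂ := if j < i then -1 else 1

/-- The sign of the mode `i` in the configuration `s`. -/
def sgn (i : ι) (s : Finset ι) : ℂ := ∏ j ∈ s, tau i j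

/-- Flipping the occupation of the mode `i`. -/
def modeFlip (i : ι) : Finset ι ≃ Finset ι where
  toFun s := symmDiff s {i}
  invFun s := symmDiff s {i}
  left_inv s := by simp
  right_inv s := by simp

theorem mem_modeFlip {i j : ι} {s : Finset ι} : j ∈ modeFlip i s ↔ ((j ∈ s ∧ j ≠ i) ∨ (j ∉ s ∧ j = i)) := by
  change j ∈ symmDiff s {i} ↔ _
  rw [Finset.mem_symmDiff, Finset.mem_singleton]
  tauto

theorem modeFlip_modeFlip (i : ι) (s : Finset ι) : modeFlip i (modeFlip i s) = s := (modeFlip i).left_inv s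

theorem modeFlip_comm (i j : ι) (s : Finset ι) : modeFlip i (modeFlip j s) = modeFlip j (modeFlip i s) := by
  change symmDiff (symmDiff s {j}) {i} = symmDiff (symmDiff s {i}) {j}
  exact symmDiff_right_comm _ _ _

theorem tau_self (i : ι) : tau i i = 1 := by simp [tau]

theorem tau_mul_self (i j : ι) : tau i j * tau i j = 1 := by
  unfold tau; split_ifs <;> norm_num

theorem tau_add {i j : ι} (h : i ≠ j) : tau i j + tau j i = 0 := by
  rcases lt_or_gt_of_ne h with h | h <;> simp [tau, h, not_lt_of_gt h]

theorem sgn_flip (i j : ι) (s : Finset ι) : sgn i (modeFlip j s) = tau i j * sgn i s := by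
  by_cases hj : j ∈ s
  · have e : modeFlip j s = s.erase j := by
      ext k
      rw [mem_modeFlip, Finset.mem_erase]
      constructor
      · rintro (h | ⟨h, rfl⟩)
        · exact h.symm
        · exact absurd hj h
      · exact fun h => Or.inl h.symm
    rw [e, sgn, sgn, ← Finset.mul_prod_erase s _ hj, ← mul_assoc, tau_mul_self, one_mul]
  · have e : modeFlip j s = insert j s := by
      ext k
      rw [mem_modeFlip, Finset.mem_insert]
      constructor
      · rintro (h | h)
        · exact Or.inr h.1
        · exact Or.inl h.2
      · rintro (rfl | h)
        · exact Or.inr ⟨hj, rfl⟩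
        · exact Or.inl ⟨h, fun e => hj (e ▸ h)⟩
    rw [e, sgn, sgn, Finset.prod_insert hj]

theorem sgn_mul_self (i : ι) (s : Finset ι) : sgn i s * sgn i s = 1 := by
  rw [sgn, ← Finset.prod_mul_distrib]
  exact Finset.prod_eq_one fun j _ => tau_mul_self i j

theorem star_sgn (i : ι) (s : Finset ι) : star (sgn i s) = sgn i s := by
  rw [sgn, star_prod]
  refine Finset.prod_congr rfl fun j _ => ?_
  unfold tau; split_ifs <;> simp

theorem norm_sgn (i : ι) (s : Finset ι) : ‖sgn i s‖ = 1 := by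
  rw [sgn, norm_prod]
  refine Finset.prod_eq_one fun j _ => ?_
  unfold tau; split_ifs <;> simp

/-- Weight of the creation operator. -/
def wCre (i : ι) (s : Finset ι) : ℂ := if i ∈ s then sgn i s else 0

/-- Weight of the annihilation operator. -/
def wAnn (i : ι) (s : Finset ι) : ℂ := if i ∈ s then 0 else sgn i s

theorem norm_wCre (i : ι) (s : Finset ι) : ‖wCre i s‖ ≤ 1 := by
  unfold wCre; split_ifs <;> simp [norm_sgn]

theorem norm_wAnn (i : ι) (s : Finset ι) : ‖wAnn i s‖ ≤ 1 := by
  unfold wAnn; split_ifs <;> simp [norm_sgn]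

theorem wAnn_flip (i : ι) (s : Finset ι) : wAnn i (modeFlip i s) = wCre i s := by
  by_cases h : i ∈ s <;> simp [wAnn, wCre, mem_modeFlip, h, sgn_flip, tau_self]

theorem wCre_flip (i : ι) (s : Finset ι) : wCre i (modeFlip i s) = wAnn i s := by
  by_cases h : i ∈ s <;> simp [wAnn, wCre, mem_modeFlip, h, sgn_flip, tau_self]

theorem wCre_flip_ne {i j : ι} (h : i ≠ j) (s : Finset ι) :
    wCre i (modeFlip j s) = tau i j * wCre i s := by
  by_cases hi : i ∈ s <;> simp [wCre, mem_modeFlip, hi, h, sgn_flip]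

theorem wAnn_flip_ne {i j : ι} (h : i ≠ j) (s : Finset ι) :
    wAnn i (modeFlip j s) = tau i j * wAnn i s := by
  by_cases hi : i ∈ s <;> simp [wAnn, mem_modeFlip, hi, h, sgn_flip]

theorem star_wAnn (i : ι) (s : Finset ι) : star (wAnn i s) = wAnn i s := by
  unfold wAnn; split_ifs <;> simp [star_sgn, -RCLike.star_def]

/-- Creation operator of the mode `i`. -/
def modeCre (i : ι) : Fock ι →L[ℂ] Fock ι := weightedPerm (wCre i) (norm_wCre i) (modeFlip i)

/-- Annihilation operator of the mode `i`. -/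
def modeAnn (i : ι) : Fock ι →L[ℂ] Fock ι := weightedPerm (wAnn i) (norm_wAnn i) (modeFlip i)

theorem modeCre_apply (i : ι) (f : Fock ι) (s : Finset ι) : modeCre i f s = wCre i s * f (modeFlip i s) := rfl

theorem modeAnn_apply (i : ι) (f : Fock ι) (s : Finset ι) : modeAnn i f s = wAnn i s * f (modeFlip i s) := rfl

theorem star_modeCre (i : ι) : star (modeCre i) = modeAnn i := by
  rw [ContinuousLinearMap.star_eq_adjoint]
  symm
  rw [ContinuousLinearMap.eq_adjoint_iff]
  intro f g
  rw [lp.inner_eq_tsum, lp.inner_eq_tsum, ← (modeFlip i).tsum_eq]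
  refine tsum_congr fun s => ?_
  rw [modeAnn_apply, modeCre_apply, modeFlip_modeFlip, wAnn_flip]
  have h : star (wCre i s) = wCre i s := by rw [← wAnn_flip, star_wAnn]
  simp only [RCLike.inner_apply, map_mul]
  rw [RCLike.star_def] at h
  rw [h]
  ring

theorem modeCre_mul_modeCre (i j : ι) : modeCre i * modeCre j + modeCre j * modeCre i = 0 := by
  ext f s
  change wCre i s * (wCre j (modeFlip i s) * f (modeFlip j (modeFlip i s)))
    + wCre j s * (wCre i (modeFlip j s) * f (modeFlip i (modeFlip j s))) = 0
  by_cases h : i = j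
  · subst h
    rw [wCre_flip]
    by_cases hi : i ∈ s <;> simp [wAnn, wCre, hi]
  · rw [wCre_flip_ne h, wCre_flip_ne (Ne.symm h), modeFlip_comm]
    linear_combination wCre i s * wCre j s * f (modeFlip i (modeFlip j s)) * tau_add h

theorem modeAnn_mul_modeCre (i j : ι) :
    modeAnn i * modeCre j + modeCre j * modeAnn i = (if i = j then (1 : ℂ) else 0) • (1 : Fock ι →L[ℂ] Fock ι) := by
  ext f s
  change wAnn i s * (wCre j (modeFlip i s) * f (modeFlip j (modeFlip i s)))
    + wCre j s * (wAnn i (modeFlip j s) * f (modeFlip i (modeFlip j s))) = (if i = j then (1 : ℂ) else 0) * f s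
  by_cases h : i = j
  · subst h
    rw [wCre_flip, wAnn_flip, modeFlip_modeFlip, if_pos rfl, one_mul]
    by_cases hi : i ∈ s <;> simp [wAnn, wCre, hi, ← mul_assoc, sgn_mul_self]
  · rw [wAnn_flip_ne h, wCre_flip_ne (Ne.symm h), modeFlip_comm, if_neg h, zero_mul]
    linear_combination wAnn i s * wCre j s * f (modeFlip i (modeFlip j s)) * tau_add h

/-- The vacuum vector. -/
def vacuum (ι : Type u) [LinearOrder ι] : Fock ι := lp.single 2 (∅ : Finset ι) (1 : ℂ)

theorem norm_vacuum : ‖vacuum ι‖ = 1 := by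
  rw [vacuum, lp.norm_single (by norm_num)]
  simp

theorem modeAnn_vacuum (i : ι) : modeAnn i (vacuum ι) = 0 := by
  ext s
  change wAnn i s * (vacuum ι) (modeFlip i s) = 0
  by_cases hi : i ∈ s
  · simp [wAnn, hi]
  · have h : modeFlip i s ≠ ∅ := by
      intro h
      have : i ∈ modeFlip i s := mem_modeFlip.2 (Or.inr ⟨hi, rfl⟩)
      simp [h] at this
    rw [vacuum, lp.single_apply_ne _ _ _ h, mul_zero]

/-- The Fock representation: creation operators over a Hilbert space `E`, together with a vacuum
vector. -/
theorem exists_fock (E : Type u) [NormedAddCommGroup E] [InnerProductSpace ℂ E] [CompleteSpace E] :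
    ∃ (F : Type u) (_ : NormedAddCommGroup F) (_ : InnerProductSpace ℂ F) (_ : CompleteSpace F)
      (c : E →L[ℂ] (F →L[ℂ] F)) (Ω : F), ‖Ω‖ = 1 ∧ (∀ g, star (c g) Ω = 0) ∧
      (∀ f g, c f * c g + c g * c f = 0) ∧
      ∀ f g, star (c f) * c g + c g * star (c f) = (inner ℂ f g : ℂ) • (1 : F →L[ℂ] F) := by
  obtain ⟨ι, b, -⟩ := exists_hilbertBasis ℂ E
  classical
  let _ : LinearOrder ι := linearOrderOfSTO WellOrderingRel
  let c₀ : (ι →₀ ℂ) →ₗ[ℂ] (Fock ι →L[ℂ] Fock ι) := Finsupp.linearCombination ℂ modeCre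
  let e₀ : (ι →₀ ℂ) →ₗ[ℂ] E := Finsupp.linearCombination ℂ b
  have hc1 : ∀ i x, c₀ (Finsupp.single i x) = x • modeCre i := fun i x => by simp [c₀]
  have he1 : ∀ i x, e₀ (Finsupp.single i x) = x • b i := fun i x => by simp [e₀]
  have h1 : ∀ v w, c₀ v * c₀ w + c₀ w * c₀ v = 0 := by
    intro v w
    induction v using Finsupp.induction_linear with
    | zero => simp
    | add v v' hv hv' =>
      rw [map_add, add_mul, mul_add, add_add_add_comm, hv, hv', add_zero]
    | single i x =>
      induction w using Finsupp.induction_linear with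
      | zero => simp
      | add w w' hw hw' =>
        rw [map_add, add_mul, mul_add, add_add_add_comm, hw, hw', add_zero]
      | single j y =>
        rw [hc1, hc1, smul_mul_smul_comm, smul_mul_smul_comm, mul_comm y x, ← smul_add,
          modeCre_mul_modeCre, smul_zero]
  have h2 : ∀ v w, star (c₀ v) * c₀ w + c₀ w * star (c₀ v)
      = (inner ℂ (e₀ v) (e₀ w) : ℂ) • (1 : Fock ι →L[ℂ] Fock ι) := by
    intro v w
    induction v using Finsupp.induction_linear with
    | zero => simp
    | add v v' hv hv' =>
      rw [map_add, map_add, star_add, add_mul, mul_add, add_add_add_comm, hv, hv', inner_add_left,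
        add_smul]
    | single i x =>
      induction w using Finsupp.induction_linear with
      | zero => simp
      | add w w' hw hw' =>
        rw [map_add, map_add, add_mul, mul_add, add_add_add_comm, hw, hw', inner_add_right,
          add_smul]
      | single j y =>
        rw [hc1, hc1, he1, he1, star_smul, star_modeCre, smul_mul_smul_comm, smul_mul_smul_comm,
          mul_comm y, ← smul_add, modeAnn_mul_modeCre, inner_smul_left, inner_smul_right,
          orthonormal_iff_ite.1 b.orthonormal i j, smul_smul]
        congr 1
        rw [RCLike.star_def, mul_assoc]
        congr
  have hn : ∀ v, ‖c₀ v‖ ≤ 1 * ‖e₀ v‖ := by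
    intro v
    have : Nontrivial (Fock ι) := ⟨vacuum ι, 0, fun h => by
      have := norm_vacuum (ι := ι)
      rw [h, norm_zero] at this
      exact zero_ne_one this⟩
    rw [one_mul]
    refine norm_le_of_anticomm (norm_nonneg _) ?_
    rw [h2, inner_self_eq_norm_sq_to_K]
    rfl
  have hd : DenseRange e₀ := by
    have h := b.dense_span
    rw [← Submodule.dense_iff_topologicalClosure_eq_top] at h
    have hr : Set.range e₀ = (Submodule.span ℂ (Set.range b) : Set E) := by
      rw [← Finsupp.range_linearCombination]
      rfl
    rw [DenseRange, hr]
    exact h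
  let c : E →L[ℂ] (Fock ι →L[ℂ] Fock ι) := c₀.extendOfNorm e₀
  have hc : ∀ v, c (e₀ v) = c₀ v := fun v => LinearMap.extendOfNorm_eq hd ⟨1, hn⟩ v
  refine ⟨Fock ι, inferInstance, inferInstance, inferInstance, c, vacuum ι, norm_vacuum,
    ?_, ?_, ?_⟩
  · intro g
    refine hd.induction_on (p := fun g => star (c g) (vacuum ι) = 0) g
      (isClosed_eq (by fun_prop) (by fun_prop)) fun v => ?_
    rw [hc]
    induction v using Finsupp.induction_linear with
    | zero => simp
    | add v v' hv hv' => rw [map_add, star_add, add_apply, hv, hv', add_zero]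
    | single i x => rw [hc1, star_smul, star_modeCre, smul_apply, modeAnn_vacuum,
        smul_zero]
  · intro f g
    refine hd.induction_on₂ (p := fun f g => c f * c g + c g * c f = 0)
      (isClosed_eq (by fun_prop) (by fun_prop)) (fun v w => ?_) f g
    rw [hc, hc, h1]
  · intro f g
    refine hd.induction_on₂ (p := fun f g => star (c f) * c g + c g * star (c f)
      = (inner ℂ f g : ℂ) • (1 : Fock ι →L[ℂ] Fock ι))
      (isClosed_eq (by fun_prop) (by fun_prop)) (fun v w => ?_) f g
    rw [hc, hc, h2]

section Wick

variable {E F : Type*} [NormedAddCommGroup E] [InnerProductSpace ℂ E]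
  [NormedAddCommGroup F] [InnerProductSpace ℂ F] [CompleteSpace F]
  {c : E →L[ℂ] (F →L[ℂ] F)} {Ω : F}

/-- An annihilation operator applied to `c(f_1) ⋯ c(f_n) Ω`. -/
theorem ann_prod_vacuum (h0 : ∀ g, star (c g) Ω = 0)
    (h2 : ∀ f g, star (c f) * c g + c g * star (c f) = (inner ℂ f g : ℂ) • (1 : F →L[ℂ] F))
    (g : E) : ∀ {n : ℕ} (f : Fin (n + 1) → E),
      star (c g) ((List.ofFn fun i => c (f i)).prod Ω) = ∑ j : Fin (n + 1),
        ((-1) ^ (j : ℕ) * (inner ℂ g (f j) : ℂ)) •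
          (List.ofFn fun i => c (f (j.succAbove i))).prod Ω := by
  have key : ∀ (f : E) (x : F), star (c g) (c f x) = (inner ℂ g f : ℂ) • x - c f (star (c g) x) :=
    fun f x => eq_sub_of_add_eq (by
      simpa using congrArg (fun T : F →L[ℂ] F => T x) (h2 g f))
  intro n
  induction n with
  | zero =>
    intro f
    simp [key, h0]
  | succ n ih =>
    intro f
    rw [List.ofFn_succ, List.prod_cons, mul_apply_eq_comp, key,
      ih (fun i => f i.succ), map_sum, Fin.sum_univ_succ (n := n + 1), sub_eq_add_neg,
      ← Finset.sum_neg_distrib]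
    congr 1
    · simp
    · refine Finset.sum_congr rfl fun j _ => ?_
      rw [List.ofFn_succ (f := fun i => c (f (j.succ.succAbove i))), List.prod_cons,
        mul_apply_eq_comp, map_smul, ← neg_smul]
      simp [pow_succ]

theorem inner_prod_prod (hΩ : ‖Ω‖ = 1) (h0 : ∀ g, star (c g) Ω = 0)
    (h2 : ∀ f g, star (c f) * c g + c g * star (c f) = (inner ℂ f g : ℂ) • (1 : F →L[ℂ] F)) :
    ∀ {n : ℕ} (g f : Fin n → E),
      inner ℂ ((List.ofFn fun i => c (g i)).prod Ω) ((List.ofFn fun i => c (f i)).prod Ω)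
        = Matrix.det (Matrix.of fun i j => (inner ℂ (g i) (f j) : ℂ)) := by
  intro n
  induction n with
  | zero =>
    intro g f
    simp [hΩ]
  | succ n ih =>
    intro g f
    rw [List.ofFn_succ (f := fun i => c (g i)), List.prod_cons, mul_apply_eq_comp,
      ← ContinuousLinearMap.adjoint_inner_right, ← ContinuousLinearMap.star_eq_adjoint,
      ann_prod_vacuum h0 h2, inner_sum, Matrix.det_succ_row_zero]
    refine Finset.sum_congr rfl fun j _ => ?_
    rw [inner_smul_right, ih]
    rfl

theorem inner_prod_prod_ne (h0 : ∀ g, star (c g) Ω = 0)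
    (h2 : ∀ f g, star (c f) * c g + c g * star (c f) = (inner ℂ f g : ℂ) • (1 : F →L[ℂ] F)) :
    ∀ {n m : ℕ} (g : Fin n → E) (f : Fin m → E), n ≠ m →
      (inner ℂ ((List.ofFn fun i => c (g i)).prod Ω) ((List.ofFn fun i => c (f i)).prod Ω) : ℂ)
        = 0 := by
  have aux : ∀ {m : ℕ} (f : Fin (m + 1) → E),
      (inner ℂ ((List.ofFn fun i => c (f i)).prod Ω) Ω : ℂ) = 0 := by
    intro m f
    rw [List.ofFn_succ, List.prod_cons, mul_apply_eq_comp,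
      ← ContinuousLinearMap.adjoint_inner_right, ← ContinuousLinearMap.star_eq_adjoint, h0,
      inner_zero_right]
  intro n
  induction n with
  | zero =>
    intro m g f h
    obtain ⟨m, rfl⟩ := Nat.exists_eq_succ_of_ne_zero (Ne.symm h)
    rw [← inner_conj_symm, show (List.ofFn fun i => c (g i)).prod Ω = Ω by simp, aux f, map_zero]
  | succ n ih =>
    intro m g f h
    cases m with
    | zero => simpa using aux g
    | succ m =>
      rw [List.ofFn_succ (f := fun i => c (g i)), List.prod_cons, mul_apply_eq_comp,
        ← ContinuousLinearMap.adjoint_inner_right, ← ContinuousLinearMap.star_eq_adjoint,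
        ann_prod_vacuum h0 h2, inner_sum]
      refine Finset.sum_eq_zero fun j _ => ?_
      rw [inner_smul_right, ih _ _ (by omega), mul_zero]

end Wick

end Fock
section Existence

variable {H : Type u} [NormedAddCommGroup H] [InnerProductSpace ℂ H] [CompleteSpace H]

theorem star_ofFn_prod {A : Type*} [Ring A] [StarRing A] :
    ∀ {n : ℕ} (f : Fin n → A),
      star (List.ofFn f).prod = (List.ofFn fun i => star (f (Fin.rev i))).prod := by
  intro n
  induction n with
  | zero =>
    intro f
    simp
  | succ n ih =>
    intro f
    rw [List.ofFn_succ, List.prod_cons, star_mul, ih, List.ofFn_succ', List.concat_eq_append,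
      List.prod_append]
    simp [Fin.rev_castSucc]

/-- Every positive contraction is the symbol of a quasi-free state: with `K = T* T` and
`1 - K = S* S`, it is the vacuum state of the representation
`a(h) ↦ a(S h ⊕ 0) + a*(0 ⊕ conj (T h))` on the Fock space over `H` plus its conjugate; the
conjugate of `H` is realised by conjugating coordinates in a Hilbert basis. -/
theorem exists_isQuasiFree (K : H →L[ℂ] H) (hK₀ : 0 ≤ K) (hK₁ : K ≤ 1) :
    ∃ φ : CAR H →ₗ[ℂ] ℂ, IsQuasiFree K φ := by
  obtain ⟨T, hT⟩ := CStarAlgebra.nonneg_iff_eq_star_mul_self.1 hK₀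
  obtain ⟨S, hS⟩ := CStarAlgebra.nonneg_iff_eq_star_mul_self.1 (sub_nonneg.2 hK₁)
  have hT' : ∀ h k, (inner ℂ (T k) (T h) : ℂ) = inner ℂ k (K h) := fun h k => by
    rw [hT, mul_apply_eq_comp, ContinuousLinearMap.star_eq_adjoint,
      ContinuousLinearMap.adjoint_inner_right]
  have hS' : ∀ h k, (inner ℂ (S k) (S h) : ℂ) = inner ℂ k h - inner ℂ k (K h) := fun h k => by
    have e : h - K h = star S (S h) := congrArg (fun R : H →L[ℂ] H => R h) hS
    rw [← inner_sub_right, e, ContinuousLinearMap.star_eq_adjoint,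
      ContinuousLinearMap.adjoint_inner_right]
  obtain ⟨ι, b, -⟩ := exists_hilbertBasis ℂ H
  let J : H → lp (fun _ : ι => ℂ) 2 := fun h => star (b.repr h)
  have hJ : ∀ h k, (inner ℂ (J h) (J k) : ℂ) = inner ℂ k h := fun h k => by
    rw [← b.repr.inner_map_map k h, lp.inner_eq_tsum, lp.inner_eq_tsum]
    refine tsum_congr fun i => ?_
    simp [J, mul_comm]
  have hJ_add : ∀ h k, J (h + k) = J h + J k := fun h k => by simp [J]
  have hJ_smul : ∀ (z : ℂ) h, J (z • h) = star z • J h := fun z h => by simp [J]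
  obtain ⟨F, _, _, _, c, Ω, hΩ, h0, h1, h2⟩ := exists_fock (WithLp 2 (H × lp (fun _ : ι => ℂ) 2))
  let p : H → WithLp 2 (H × lp (fun _ : ι => ℂ) 2) := fun h => WithLp.toLp 2 (S h, 0)
  let q : H → WithLp 2 (H × lp (fun _ : ι => ℂ) 2) := fun h =>
    WithLp.toLp 2 (0, J (T h))
  have hpq : ∀ h k, (inner ℂ (p h) (q k) : ℂ) = 0 := fun h k => by
    simp [p, q, WithLp.prod_inner_apply]
  have hqp : ∀ h k, (inner ℂ (q h) (p k) : ℂ) = 0 := fun h k => by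
    simp [p, q, WithLp.prod_inner_apply]
  have hpp : ∀ h k, (inner ℂ (p h) (p k) : ℂ) = inner ℂ (S h) (S k) := fun h k => by
    simp [p, WithLp.prod_inner_apply]
  have hqq : ∀ h k, (inner ℂ (q h) (q k) : ℂ) = inner ℂ (T k) (T h) := fun h k => by
    simp [q, WithLp.prod_inner_apply, hJ]
  have hp_add : ∀ h k, p (h + k) = p h + p k := fun h k => by
    simp [p, ← WithLp.toLp_add]
  have hq_add : ∀ h k, q (h + k) = q h + q k := fun h k => by
    simp [q, ← WithLp.toLp_add, hJ_add]
  have hp_smul : ∀ (z : ℂ) h, p (z • h) = z • p h := fun z h => by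
    simp [p, ← WithLp.toLp_smul]
  have hq_smul : ∀ (z : ℂ) h, q (z • h) = star z • q h := fun z h => by
    simp [q, ← WithLp.toLp_smul, hJ_smul]
  have hnt : Nontrivial F := ⟨Ω, 0, fun h => by
    rw [h, norm_zero] at hΩ
    exact zero_ne_one hΩ⟩
  let π : CARRep H :=
    { carrier := F →L[ℂ] F
      ann :=
        { toFun := fun h => star (c (p h)) + c (q h)
          map_add' := fun h k => by
            rw [hp_add, hq_add, map_add, map_add, star_add]
            abel
          map_smul' := fun z h => by
            rw [hp_smul, hq_smul, map_smul, map_smul, star_smul, smul_add]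
            rfl }
      ann_mul_ann := fun h k => by
        change (star (c (p h)) + c (q h)) * (star (c (p k)) + c (q k))
          + (star (c (p k)) + c (q k)) * (star (c (p h)) + c (q h)) = 0
        have e1 : star (c (p h)) * star (c (p k)) + star (c (p k)) * star (c (p h)) = 0 := by
          rw [← star_mul, ← star_mul, ← star_add, h1, star_zero]
        have e2 := h1 (q h) (q k)
        have e3 := h2 (p h) (q k)
        have e4 := h2 (p k) (q h)
        rw [hpq, zero_smul] at e3 e4
        have e5 : ∀ x y z w : F →L[ℂ] F, x * z + z * x = 0 → y * w + w * y = 0 →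
            x * w + w * x = 0 → z * y + y * z = 0 →
            (x + y) * (z + w) + (z + w) * (x + y) = 0 := by
          intro x y z w i1 i2 i3 i4
          have : (x + y) * (z + w) + (z + w) * (x + y) = (x * z + z * x) + (y * w + w * y)
            + (x * w + w * x) + (z * y + y * z) := by
            simp only [mul_add, add_mul]
            abel
          rw [this, i1, i2, i3, i4, add_zero, add_zero, add_zero]
        exact e5 _ _ _ _ e1 e2 e3 e4
      star_ann_mul_ann := fun h k => by
        change star (star (c (p h)) + c (q h)) * (star (c (p k)) + c (q k))
          + (star (c (p k)) + c (q k)) * star (star (c (p h)) + c (q h)) = _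
        rw [star_add, star_star]
        have e1 := h2 (p k) (p h)
        have e2 := h2 (q h) (q k)
        have e3 := h1 (p h) (q k)
        have e4 : star (c (q h)) * star (c (p k)) + star (c (p k)) * star (c (q h)) = 0 := by
          rw [← star_mul, ← star_mul, ← star_add, h1, star_zero]
        have e5 : (inner ℂ k h : ℂ) • (1 : F →L[ℂ] F)
            = (inner ℂ (p k) (p h) : ℂ) • (1 : F →L[ℂ] F)
              + (inner ℂ (q h) (q k) : ℂ) • (1 : F →L[ℂ] F) := by
          rw [← add_smul, hpp, hqq, hS', hT', sub_add_cancel]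
        rw [e5, ← e1, ← e2]
        have e6 : ∀ x y z w : F →L[ℂ] F, x * w + w * x = 0 → z * y + y * z = 0 →
            (x + z) * (y + w) + (y + w) * (x + z) = y * x + x * y + (z * w + w * z) := by
          intro x y z w hx hz
          have : (x + z) * (y + w) + (y + w) * (x + z) = (y * x + x * y + (z * w + w * z))
            + (x * w + w * x) + (z * y + y * z) := by
            simp only [mul_add, add_mul]
            abel
          rw [this, hx, hz, add_zero, add_zero]
        exact e6 _ _ _ _ e3 e4 }
  have hπ : ∀ h, π.ann h = star (c (p h)) + c (q h) := fun h => rfl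
  have hvec : ∀ {n : ℕ} (k : Fin n → H), (List.ofFn fun i => π.ann (k i)).prod Ω
      = (List.ofFn fun i => c (q (k i))).prod Ω := by
    intro n
    induction n with
    | zero =>
      intro k
      simp
    | succ n ih =>
      intro k
      rw [List.ofFn_succ, List.prod_cons, List.ofFn_succ, List.prod_cons]
      change π.ann (k 0) ((List.ofFn fun i => π.ann (k i.succ)).prod Ω) = _
      rw [ih, hπ, add_apply, mul_apply_eq_comp, add_eq_right]
      cases n with
      | zero => simp [h0]
      | succ n =>
        rw [ann_prod_vacuum h0 h2]
        exact Finset.sum_eq_zero fun j _ => by rw [hpq, mul_zero, zero_smul]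
  let ψ : (F →L[ℂ] F) →ₗ[ℂ] ℂ :=
    { toFun := fun R => inner ℂ Ω (R Ω)
      map_add' := fun R R' => by rw [add_apply, inner_add_right]
      map_smul' := fun z R => by rw [smul_apply, inner_smul_right]; rfl }
  let φ : CAR H →ₗ[ℂ] ℂ := ψ.comp (CAR.lift π).toAlgHom.toLinearMap
  have hφ : ∀ {n m : ℕ} (h : Fin n → H) (k : Fin m → H), φ (monomial h k)
      = inner ℂ ((List.ofFn fun i => c (q (h (Fin.rev i)))).prod Ω)
        ((List.ofFn fun i => c (q (k i))).prod Ω) := by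
    intro n m h k
    change inner ℂ Ω ((CAR.lift π (monomial h k)) Ω) = _
    have e : CAR.lift π (monomial h k) = star (List.ofFn fun i => π.ann (h (Fin.rev i))).prod
        * (List.ofFn fun i => π.ann (k i)).prod := by
      rw [monomial, map_mul, map_list_prod, map_list_prod, List.map_ofFn, List.map_ofFn,
        star_ofFn_prod]
      simp only [Function.comp_def, map_star, Fin.rev_rev]
      rfl
    rw [e]
    change inner ℂ Ω ((star (List.ofFn fun i => π.ann (h (Fin.rev i))).prod : F →L[ℂ] F)
      ((List.ofFn fun i => π.ann (k i)).prod Ω)) = _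
    rw [ContinuousLinearMap.star_eq_adjoint, ContinuousLinearMap.adjoint_inner_right, hvec, hvec]
  refine ⟨φ, ⟨?_, ?_⟩, ?_, ?_⟩
  · change inner ℂ Ω ((CAR.lift π 1) Ω) = (1 : ℂ)
    rw [map_one]
    change inner ℂ Ω Ω = (1 : ℂ)
    rw [inner_self_eq_norm_sq_to_K, hΩ]
    simp
  · intro x
    change 0 ≤ (inner ℂ Ω ((CAR.lift π (star x * x)) Ω) : ℂ)
    rw [map_mul, map_star]
    change 0 ≤ (inner ℂ Ω ((star (CAR.lift π x) : F →L[ℂ] F) ((CAR.lift π x : F →L[ℂ] F) Ω)) : ℂ)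
    rw [ContinuousLinearMap.star_eq_adjoint, ContinuousLinearMap.adjoint_inner_right]
    rw [inner_self_eq_norm_sq_to_K]
    have hnn := Complex.zero_le_real.2 (sq_nonneg ‖(CAR.lift π x : F →L[ℂ] F) Ω‖)
    rw [Complex.ofReal_pow] at hnn
    exact hnn
  · intro n h k
    rw [hφ]
    simp only [Function.comp_apply, Fin.rev_rev]
    rw [inner_prod_prod hΩ h0 h2]
    simp only [hqq, hT']
  · intro n m h k hnm
    rw [hφ, inner_prod_prod_ne h0 h2 _ _ hnm]

/-- The quasi-free state with symbol `K`; a state is continuous, hence determined by its values on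
the monomials, so the choice is immaterial. -/
def quasiFreeState (K : H →L[ℂ] H) (hK₀ : 0 ≤ K) (hK₁ : K ≤ 1) : CAR H →ₗ[ℂ] ℂ :=
  (exists_isQuasiFree K hK₀ hK₁).choose

theorem quasiFreeState_spec (K : H →L[ℂ] H) (hK₀ : 0 ≤ K) (hK₁ : K ≤ 1) :
    IsQuasiFree K (quasiFreeState K hK₀ hK₁) :=
  (exists_isQuasiFree K hK₀ hK₁).choose_spec

/-- The restriction of the quasi-free state with symbol `K` to the GICAR algebra. -/
def gicarState (K : H →L[ℂ] H) (hK₀ : 0 ≤ K) (hK₁ : K ≤ 1) : gicar H →ₗ[ℂ] ℂ :=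
  (quasiFreeState K hK₀ hK₁).comp (gicar H).subtype.toAlgHom.toLinearMap

end Existence

/-- `(ρ, E, Ω)` is a GNS triple of the functional `φ`. -/
structure IsGNSTriple {A : Type*} [Ring A] [StarRing A] [Algebra ℂ A] (φ : A →ₗ[ℂ] ℂ)
    {E : Type*} [NormedAddCommGroup E] [InnerProductSpace ℂ E] [CompleteSpace E]
    (ρ : A →⋆ₐ[ℂ] (E →L[ℂ] E)) (Ω : E) : Prop where
  cyclic : Dense (Set.range fun x => ρ x Ω)
  inner_eq : ∀ x, inner ℂ Ω (ρ x Ω) = φ x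

/-- The (unbounded) operator `A` commutes with the bounded operator `K`: `K A ⊆ A K`. -/
def Commutes {H : Type*} [NormedAddCommGroup H] [InnerProductSpace ℂ H] (A : H →ₗ.[ℂ] H)
    (K : H →L[ℂ] H) : Prop :=
  ∀ x : A.domain, ∃ hx : K x ∈ A.domain, A ⟨K x, hx⟩ = K (A x)

section Dynamics

variable {H : Type u} [NormedAddCommGroup H] [InnerProductSpace ℂ H]
  {E : Type*} [NormedAddCommGroup E] [InnerProductSpace ℂ E] [CompleteSpace E]

/-- `Γ t (ρ(x) Ω) = ρ(γ_{U t}(x)) Ω` for all `t` and all `x` in the GICAR algebra. -/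
def Implements (Γ : UnitaryGroup E) (U : UnitaryGroup H) (ρ : gicar H →⋆ₐ[ℂ] (E →L[ℂ] E))
    (Ω : E) : Prop :=
  ∀ (t : ℝ) (x : gicar H), Γ t (ρ x Ω) = ρ (bogoliubov (U t) x) Ω

/-- The span of the vectors `ρ(a*(h_1) ⋯ a*(h_n) a(k_1) ⋯ a(k_n)) Ω` with `n ≥ 0` and all `h_i`,
`k_i` in `V`. -/
def monomialSpan (ρ : gicar H →⋆ₐ[ℂ] (E →L[ℂ] E)) (Ω : E) (V : Submodule ℂ H) : Submodule ℂ E :=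
  Submodule.span ℂ {v | ∃ (n : ℕ) (h k : Fin n → H),
    (∀ i, h i ∈ V) ∧ (∀ i, k i ∈ V) ∧ v = ρ (gicarMonomial h k) Ω}

end Dynamics

end GICAR

end

namespace GICAR

/-! ### Generators of unitary groups -/

namespace UnitaryGroup

variable {E : Type*} [NormedAddCommGroup E] [InnerProductSpace ℂ E]

/-! Since `A` commutes with `K`, so does each `U t`: the scalar function `⟨U_t x, K U_t y⟩` has zero
derivative on the domain of `A` (`inner_apply_apply_of_commutes`). The determinants defining the
quasi-free state are therefore unchanged by `γ_{U_t}`, and as the balanced monomials span a dense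
subspace of the gauge-invariant algebra (`dense_gicarMonomialSpan`), the state itself is invariant.
Hence `ρ(x)Ω ↦ ρ(γ_{U_t}(x))Ω` is isometric on a dense subspace and extends to the whole space. The
group law passes to the extension by density, and strong continuity because monomials depend
continuously on their vectors (`exists_implements`).

The core statement is an instance of Nelson's criterion: a dense subspace of the domain that is
invariant under the group is a core (`hasCore_generator`). Its three hypotheses hold for the span of
monomial vectors over `V`. Density follows from that of `V`, of the balanced monomials and of the
cyclic orbit (`dense_monomialSpan`). The vectors lie in the domain because a monomial is a product
of differentiable curves (`differentiableAt_clm_gicarMonomial`). Invariance holds because `γ_{U_t}`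
acts on a monomial by moving its vectors inside `V`. -/

theorem hasDerivAt_zero (U : UnitaryGroup E) (x : U.generator.domain) :
    HasDerivAt (fun t : ℝ => U t (x : E)) (Complex.I • U.generator x) 0 := by
  have h : U.generator x = (-Complex.I) • deriv (fun t : ℝ => U t (x : E)) 0 := rfl
  rw [h, smul_smul, mul_neg, Complex.I_mul_I, neg_neg, one_smul]
  exact DifferentiableAt.hasDerivAt x.2

theorem mem_graph_generator (U : UnitaryGroup E) {x y : E}
    (h : HasDerivAt (fun t : ℝ => U t x) (Complex.I • y) 0) : (x, y) ∈ U.generator.graph := by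
  rw [LinearPMap.mem_graph_iff]
  refine ⟨⟨x, h.differentiableAt⟩, rfl, ?_⟩
  change (-Complex.I) • deriv (fun t : ℝ => U t x) 0 = y
  rw [h.deriv, smul_smul, neg_mul, Complex.I_mul_I, neg_neg, one_smul]

theorem hasDerivAt_apply (U : UnitaryGroup E) (x : U.generator.domain) (t : ℝ) :
    HasDerivAt (fun s : ℝ => U s (x : E)) (Complex.I • U t (U.generator x)) t := by
  have h0 : HasDerivAt (fun s : ℝ => U s (x : E)) (Complex.I • U.generator x) (t - t) := by
    rw [sub_self]
    exact U.hasDerivAt_zero x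
  have h1 := h0.comp_sub_const t t
  let L : E →L[ℝ] E := ((U t : E ≃L[ℂ] E) : E →L[ℂ] E).restrictScalars ℝ
  have h2 := L.hasFDerivAt.comp_hasDerivAt t h1
  have e : (L ∘ fun s : ℝ => U (s - t) (x : E)) = fun s => U s (x : E) := by
    funext s
    change U t (U (s - t) (x : E)) = _
    rw [← U.map_add', add_sub_cancel]
  rw [e] at h2
  convert h2 using 1
  exact (map_smul (U t) _ _).symm

/-- The group is commutative, so the derivative at `0` along `U t x` is the derivative at `t` along
`x`. Graph membership records at once that the domain is invariant and that the generator commutes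
with `U t`. -/
theorem apply_mem_graph_generator (U : UnitaryGroup E) (x : U.generator.domain) (t : ℝ) :
    (U t (x : E), U t (U.generator x)) ∈ U.generator.graph := by
  refine U.mem_graph_generator ?_
  have h := U.hasDerivAt_apply x t
  rw [← zero_add t] at h
  have h1 := h.comp_add_const 0 t
  simpa only [U.map_add', U.map_zero', zero_add] using h1

/-- Unitarity makes `t ↦ ⟨U_t x, U_t y⟩` constant; its derivative at `0` is `i(⟨x, By⟩ - ⟨Bx, y⟩)`,
with `B` the generator. -/
theorem inner_generator (U : UnitaryGroup E) (x y : U.generator.domain) :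
    (inner ℂ (U.generator x) (y : E) : ℂ) = inner ℂ (x : E) (U.generator y) := by
  have h := (U.hasDerivAt_zero x).inner ℂ (U.hasDerivAt_zero y)
  simp only [LinearIsometryEquiv.inner_map_map, U.map_zero', inner_smul_left, inner_smul_right,
    Complex.conj_I] at h
  have h' := h.unique (hasDerivAt_const (0 : ℝ) _)
  have h2 : Complex.I * ((inner ℂ (x : E) (U.generator y) : ℂ)
      - inner ℂ (U.generator x) (y : E)) = 0 := by
    linear_combination h'
  exact (sub_eq_zero.1 ((mul_eq_zero.1 h2).resolve_left Complex.I_ne_zero)).symm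

/-- Symmetry makes `⟨Bx, x⟩` real, so the cross term is purely imaginary. Consequently the norm of
`(B + i)x` controls both `x` and `Bx`, that is, the graph norm. -/
theorem norm_sq_generator_add (U : UnitaryGroup E) (x : U.generator.domain) :
    ‖U.generator x + Complex.I • (x : E)‖ ^ 2 = ‖U.generator x‖ ^ 2 + ‖(x : E)‖ ^ 2 := by
  have h := norm_add_sq (𝕜 := ℂ) (U.generator x) (Complex.I • (x : E))
  have e : RCLike.re (inner ℂ (U.generator x) (Complex.I • (x : E)) : ℂ) = 0 := by
    have hs := U.inner_generator x x
    rw [← inner_conj_symm (x : E)] at hs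
    have him := Complex.conj_eq_iff_im.1 hs.symm
    rw [inner_smul_right]
    simp [him]
  rw [h, e, norm_smul, Complex.norm_I]
  ring

/-- If `v_n → x` and `B v_n → y`, the derivatives `i U_t B v_n` converge to `i U_t y` uniformly in
`t`, because every `U t` is an isometry. Limit and derivative may then be exchanged. -/
theorem generator_isClosed (U : UnitaryGroup E) : U.generator.IsClosed := by
  refine isClosed_of_closure_subset fun p hp => ?_
  obtain ⟨u, hu, hlim⟩ := mem_closure_iff_seq_limit.1 hp
  choose v hv using fun n => (LinearPMap.mem_graph_iff _).1 (hu n)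
  have h1 : Filter.Tendsto (fun n => (v n : E)) Filter.atTop (nhds p.1) := by
    simpa only [(hv _).1, Function.comp_def] using (continuous_fst.tendsto p).comp hlim
  have h2 : Filter.Tendsto (fun n => U.generator (v n)) Filter.atTop (nhds p.2) := by
    simpa only [(hv _).2, Function.comp_def] using (continuous_snd.tendsto p).comp hlim
  have hd := hasDerivAt_of_tendstoUniformly (𝕜 := ℝ) (l := Filter.atTop)
    (f := fun n (t : ℝ) => U t (v n : E)) (g := fun t => U t p.1)
    (f' := fun n t => Complex.I • U t (U.generator (v n))) (g' := fun t => Complex.I • U t p.2)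
    (by
      rw [Metric.tendstoUniformly_iff]
      intro ε hε
      filter_upwards [Metric.tendsto_nhds.1 h2 ε hε] with n hn t
      rw [dist_smul₀, Complex.norm_I, one_mul, LinearIsometryEquiv.dist_map, dist_comm]
      exact hn)
    (Filter.Eventually.of_forall fun n t => U.hasDerivAt_apply (v n) t)
    (fun t => ((U t).continuous.tendsto _).comp h1) 0
  simp only [U.map_zero'] at hd
  exact U.mem_graph_generator hd

/-- If `f' = f` on the line and `f` is bounded, then `f 0 = 0`. -/
theorem eq_zero_of_hasDerivAt_self {f : ℝ → ℂ} {C : ℝ} (hf : ∀ t, HasDerivAt f (f t) t)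
    (hC : ∀ t, ‖f t‖ ≤ C) : f 0 = 0 := by
  -- The product `e^{-t} f(t)` is constant, and boundedness of `f` forces it to `0` as `t → ∞`.
  have hg : ∀ t : ℝ, HasDerivAt (fun s : ℝ => (Real.exp (-s) : ℂ) * f s) 0 t := fun t => by
    have h1 : HasDerivAt (fun s : ℝ => (Real.exp (-s) : ℂ)) ((Real.exp (-t) * -1 : ℝ) : ℂ) t :=
      ((hasDerivAt_neg t).exp).ofReal_comp
    refine (h1.mul (hf t)).congr_deriv ?_
    push_cast
    ring
  have hconst : ∀ t : ℝ, f 0 = (Real.exp (-t) : ℂ) * f t := fun t => by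
    have := is_const_of_deriv_eq_zero (fun t => (hg t).differentiableAt) (fun t => (hg t).deriv) 0 t
    simpa using this
  have hle : ∀ t : ℝ, ‖f 0‖ ≤ Real.exp (-t) * C := fun t => by
    rw [hconst t, norm_mul, Complex.norm_real, Real.norm_of_nonneg (Real.exp_nonneg _)]
    exact mul_le_mul_of_nonneg_left (hC t) (Real.exp_nonneg _)
  have hlim : Filter.Tendsto (fun t : ℝ => Real.exp (-t) * C) Filter.atTop (nhds (0 * C)) :=
    (Real.tendsto_exp_neg_atTop_nhds_zero).mul_const C
  rw [zero_mul] at hlim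
  exact norm_le_zero_iff.1 (ge_of_tendsto' hlim hle)

/-- A dense invariant subspace of the domain is a core for the generator. -/
theorem hasCore_generator [CompleteSpace E] (U : UnitaryGroup E) {D : Submodule ℂ E}
    (hD : Dense (D : Set E)) (hdom : D ≤ U.generator.domain)
    (hinv : ∀ t : ℝ, ∀ x ∈ D, U t x ∈ D) : U.generator.HasCore D := by
  -- `R` is `B + i` restricted to `D`. Density of its range suffices, without the companion
  -- statement for `B - i`, because the symmetric extension `B` to be recovered is already given.
  let R : D →ₗ[ℂ] E :=
    { toFun := fun x => U.generator ⟨x, hdom x.2⟩ + Complex.I • (x : E)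
      map_add' := fun x y => by
        have : (⟨((x + y : D) : E), hdom (x + y).2⟩ : U.generator.domain)
          = ⟨x, hdom x.2⟩ + ⟨y, hdom y.2⟩ := rfl
        rw [this, LinearPMap.map_add, Submodule.coe_add, smul_add]
        abel
      map_smul' := fun c x => by
        have : (⟨((c • x : D) : E), hdom (c • x).2⟩ : U.generator.domain) = c • ⟨x, hdom x.2⟩ := rfl
        rw [this, LinearPMap.map_smul, Submodule.coe_smul, RingHom.id_apply, smul_add, smul_comm c] }
  have hR : Dense (LinearMap.range R : Set E) := by
    rw [Submodule.dense_iff_topologicalClosure_eq_top, Submodule.topologicalClosure_eq_top_iff,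
      Submodule.eq_bot_iff]
    intro z hz
    rw [Submodule.mem_orthogonal'] at hz
    refine hD.eq_zero_of_inner_left (𝕜 := ℂ) fun y hyD => ?_
    have hy := hdom hyD
    -- For `z` orthogonal to the range of `R`, the function `f(t) = ⟨z, U_t y⟩` satisfies `f' = i⟨z,
    -- B U_t y⟩ = f`; invariance of `D` is what lets orthogonality be used at `U_t y`. Being
    -- bounded, `f` vanishes at `0`, so `z` is orthogonal to the dense `D`.
    have key := eq_zero_of_hasDerivAt_self (f := fun t => inner ℂ z (U t y))
      (C := ‖z‖ * ‖y‖) (fun t => ?_) fun t => ?_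
    · simpa only [U.map_zero'] using key
    · have h1 := (hasDerivAt_const t z).inner ℂ (U.hasDerivAt_apply ⟨y, hy⟩ t)
      obtain ⟨w, hw1, hw2⟩ := (LinearPMap.mem_graph_iff _).1 (U.apply_mem_graph_generator ⟨y, hy⟩ t)
      have hwD : (w : E) ∈ D := hw1 ▸ hinv t y hyD
      have h2 := hz (R ⟨w, hwD⟩) ⟨_, rfl⟩
      change inner ℂ z (U.generator w + Complex.I • (w : E)) = 0 at h2
      rw [inner_add_right, inner_smul_right] at h2
      refine h1.congr_deriv ?_
      rw [inner_smul_right, inner_zero_left, add_zero]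
      simp only at hw1 hw2
      rw [← hw2, ← hw1]
      linear_combination Complex.I * h2 - inner ℂ z (w : E) * Complex.I_mul_I
    · simpa using norm_inner_le_norm (𝕜 := ℂ) z (U t y)
  have hcl : U.generator.IsClosed := U.generator_isClosed
  have hle : U.generator.domRestrict D ≤ U.generator := LinearPMap.domRestrict_le
  have hcb : (U.generator.domRestrict D).IsClosable := hcl.isClosable.leIsClosable hle
  refine ⟨hdom, LinearPMap.eq_of_eq_graph (le_antisymm ?_ ?_)⟩
  · rw [← hcb.graph_closure_eq_closure_graph]
    exact Submodule.topologicalClosure_minimal _ (LinearPMap.le_graph_of_le hle) hcl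
  · rw [← hcb.graph_closure_eq_closure_graph]
    rintro ⟨x, y⟩ hxy
    obtain ⟨v, hv1, hv2⟩ := (LinearPMap.mem_graph_iff _).1 hxy
    simp only at hv1 hv2
    subst hv1 hv2
    rw [← SetLike.mem_coe, Submodule.topologicalClosure_coe, Metric.mem_closure_iff]
    intro ε hε
    -- Approximating `(B + i)v` by `(B + i)u` with `u` in `D` approximates `v` and `Bv`
    -- simultaneously, by the norm identity applied to `v - u`.
    obtain ⟨_, hu, ⟨u, rfl⟩⟩ := Metric.dense_iff.1 hR (U.generator v + Complex.I • (v : E)) ε hε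
    have hudom := hdom u.2
    refine ⟨((u : E), U.generator ⟨u, hudom⟩), ?_, ?_⟩
    · rw [SetLike.mem_coe, LinearPMap.mem_graph_iff]
      exact ⟨⟨u, u.2, hudom⟩, rfl, rfl⟩
    · have h1 := U.norm_sq_generator_add (v - ⟨u, hudom⟩)
      rw [LinearPMap.map_sub, Submodule.coe_sub, smul_sub] at h1
      have h2 : ‖U.generator v - U.generator ⟨u, hudom⟩ + (Complex.I • (v : E) - Complex.I • (u : E))‖ < ε := by
        rw [Metric.mem_ball, dist_comm, dist_eq_norm] at hu
        rw [sub_add_sub_comm]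
        exact hu
      rw [Prod.dist_eq, max_lt_iff, dist_eq_norm, dist_eq_norm]
      refine ⟨lt_of_le_of_lt ?_ h2, lt_of_le_of_lt ?_ h2⟩ <;>
        refine le_of_sq_le_sq ?_ (norm_nonneg _) <;> rw [h1]
      · exact le_add_of_nonneg_left (sq_nonneg _)
      · exact le_add_of_nonneg_right (sq_nonneg _)

/-- A unitary group whose generator commutes with a bounded operator commutes with it. -/
theorem inner_apply_apply_of_commutes (U : UnitaryGroup E) {K : E →L[ℂ] E}
    (hd : Dense (U.generator.domain : Set E)) (hK : Commutes U.generator K) (t : ℝ) (x y : E) :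
    (inner ℂ (U t x) (K (U t y)) : ℂ) = inner ℂ x (K y) := by
  have hdr : DenseRange (Subtype.val : U.generator.domain → E) := by
    simpa [DenseRange] using hd
  refine hdr.induction_on₂ (p := fun x y => (inner ℂ (U t x) (K (U t y)) : ℂ) = inner ℂ x (K y))
    (isClosed_eq (by fun_prop) (by fun_prop)) (fun x y => ?_) x y
  -- The derivative is `i(⟨U_s x, K B U_s y⟩ - ⟨B U_s x, K U_s y⟩)`. It vanishes once `K B` is
  -- replaced by `B K` and `B` is moved across by symmetry.
  have hder : ∀ s : ℝ, HasDerivAt (fun r : ℝ => (inner ℂ (U r (x : E)) (K (U r (y : E))) : ℂ)) 0 s := by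
    intro s
    have h1 := U.hasDerivAt_apply x s
    have h2 := (K.restrictScalars ℝ).hasFDerivAt.comp_hasDerivAt s (U.hasDerivAt_apply y s)
    have h3 := h1.inner ℂ h2
    refine h3.congr_deriv ?_
    obtain ⟨v, hv1, hv2⟩ := (LinearPMap.mem_graph_iff _).1 (U.apply_mem_graph_generator x s)
    obtain ⟨w, hw1, hw2⟩ := (LinearPMap.mem_graph_iff _).1 (U.apply_mem_graph_generator y s)
    simp only at hv1 hv2 hw1 hw2
    obtain ⟨hKw, e⟩ := hK w
    change inner ℂ (U s (x : E)) (K (Complex.I • U s (U.generator y)))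
      + inner ℂ (Complex.I • U s (U.generator x)) (K (U s (y : E))) = 0
    rw [← hv1, ← hv2, ← hw1, ← hw2, map_smul, ← e, inner_smul_left, inner_smul_right,
      Complex.conj_I]
    have := U.inner_generator v ⟨_, hKw⟩
    simp only at this
    rw [this]
    ring
  have := is_const_of_deriv_eq_zero (fun t => (hder t).differentiableAt) (fun t => (hder t).deriv) t 0
  simpa only [U.map_zero'] using this

end UnitaryGroup

section Algebra

variable {H : Type u} [NormedAddCommGroup H] [InnerProductSpace ℂ H]

/-! ### Monomials in the CAR algebra -/

theorem norm_a_le (h : H) : ‖a h‖ ≤ ‖h‖ :=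
  lp.norm_le_of_forall_le (norm_nonneg h) fun π => π.norm_ann_le h

/-- `h ↦ a(h)` as a continuous real-linear map. -/
noncomputable def annCLM : H →L[ℝ] CAR H :=
  LinearMap.mkContinuous
    { toFun := a
      map_add' := fun h k => by
        ext π
        exact π.ann.map_add h k
      map_smul' := fun c h => by
        change a ((c : ℂ) • h) = (c : ℂ) • a h
        rw [a_smul]
        simp } 1 fun h => by
    rw [one_mul]
    exact norm_a_le h

theorem continuous_a : Continuous (a : H → CAR H) := (annCLM (H := H)).continuous

theorem continuous_prod_ofFn {X M : Type*} [TopologicalSpace X] [TopologicalSpace M] [Monoid M]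
    [ContinuousMul M] {n : ℕ} {f : Fin n → X → M} (hf : ∀ i, Continuous (f i)) :
    Continuous fun x => (List.ofFn fun i => f i x).prod := by
  simp only [List.ofFn_eq_map]
  exact continuous_list_prod _ fun i _ => hf i

theorem continuous_monomial {X : Type*} [TopologicalSpace X] {n m : ℕ} {h : X → Fin n → H}
    {k : X → Fin m → H} (hh : Continuous h) (hk : Continuous k) :
    Continuous fun x => monomial (h x) (k x) := by
  refine Continuous.mul (continuous_prod_ofFn fun i => ?_) (continuous_prod_ofFn fun i => ?_)
  · exact (continuous_a.comp ((continuous_apply i).comp hh)).star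
  · exact continuous_a.comp ((continuous_apply i).comp hk)

theorem differentiableAt_prod_ofFn {M : Type*} [NormedRing M] [NormedAlgebra ℝ M] {t : ℝ} {n : ℕ}
    {f : Fin n → ℝ → M} (hf : ∀ i, DifferentiableAt ℝ (f i) t) :
    DifferentiableAt ℝ (fun x => (List.ofFn fun i => f i x).prod) t := by
  simp only [List.ofFn_eq_map]
  exact (HasFDerivAt.list_prod' fun i _ => (hf i).hasFDerivAt).differentiableAt

theorem differentiableAt_monomial {t : ℝ} {n m : ℕ} {h : Fin n → ℝ → H} {k : Fin m → ℝ → H}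
    (hh : ∀ i, DifferentiableAt ℝ (h i) t) (hk : ∀ i, DifferentiableAt ℝ (k i) t) :
    DifferentiableAt ℝ (fun x => monomial (fun i => h i x) (fun i => k i x)) t := by
  have ha : ∀ {f : ℝ → H}, DifferentiableAt ℝ f t → DifferentiableAt ℝ (fun x => a (f x)) t :=
    fun hf => (annCLM (H := H)).differentiableAt.comp t hf
  exact (differentiableAt_prod_ofFn fun i => (ha (hh i)).star).mul
    (differentiableAt_prod_ofFn fun i => ha (hk i))

/-! ### Normal ordering in the CAR algebra -/

variable (H) in
/-- The span of all normally ordered monomials. -/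
noncomputable def normalOrderedSpan : Submodule ℂ (CAR H) :=
  Submodule.span ℂ {x | ∃ (n m : ℕ) (h : Fin n → H) (k : Fin m → H), x = monomial h k}

theorem monomial_mem_normalOrderedSpan {n m : ℕ} (h : Fin n → H) (k : Fin m → H) :
    monomial h k ∈ normalOrderedSpan H :=
  Submodule.subset_span ⟨n, m, h, k, rfl⟩

theorem star_a_mul_monomial (f : H) {n m : ℕ} (h : Fin n → H) (k : Fin m → H) :
    star (a f) * monomial h k = monomial (Fin.cons f h) k := by
  simp [monomial, List.ofFn_succ, mul_assoc]

theorem star_a_mul_mem (f : H) {x : CAR H} (hx : x ∈ normalOrderedSpan H) :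
    star (a f) * x ∈ normalOrderedSpan H := by
  induction hx using Submodule.span_induction with
  | mem x hx =>
    obtain ⟨n, m, h, k, rfl⟩ := hx
    rw [star_a_mul_monomial]
    exact monomial_mem_normalOrderedSpan _ _
  | zero => simp
  | add x y _ _ hx hy => rw [mul_add]; exact add_mem hx hy
  | smul c x _ hx => rw [mul_smul_comm]; exact Submodule.smul_mem _ c hx

/-- Induction on the number of creation operators: the anticommutation relation moves `a f` past the
first of them, up to sign, leaving a scalar multiple of a shorter monomial. -/
theorem a_mul_monomial_mem (f : H) : ∀ {n m : ℕ} (h : Fin n → H) (k : Fin m → H),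
    a f * monomial h k ∈ normalOrderedSpan H := by
  intro n
  induction n with
  | zero =>
    intro m h k
    have e : a f * monomial h k = monomial h (Fin.cons f k : Fin (m + 1) → H) := by
      simp [monomial, List.ofFn_succ]
    rw [e]
    exact monomial_mem_normalOrderedSpan _ _
  | succ n ih =>
    intro m h k
    have e : monomial h k = star (a (h 0)) * monomial (Fin.tail h) k := by
      rw [star_a_mul_monomial, Fin.cons_self_tail]
    have e2 : a f * star (a (h 0)) = (inner ℂ f (h 0) : ℂ) • (1 : CAR H) - star (a (h 0)) * a f :=
      eq_sub_of_add_eq' (star_a_mul_a (h 0) f)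
    rw [e, ← mul_assoc, e2, sub_mul, smul_mul_assoc, one_mul, mul_assoc]
    exact sub_mem (Submodule.smul_mem _ _ (monomial_mem_normalOrderedSpan _ _))
      (star_a_mul_mem _ (ih _ _))

theorem a_mul_mem (f : H) {x : CAR H} (hx : x ∈ normalOrderedSpan H) :
    a f * x ∈ normalOrderedSpan H := by
  induction hx using Submodule.span_induction with
  | mem x hx =>
    obtain ⟨n, m, h, k, rfl⟩ := hx
    exact a_mul_monomial_mem _ _ _
  | zero => simp
  | add x y _ _ hx hy => rw [mul_add]; exact add_mem hx hy
  | smul c x _ hx => rw [mul_smul_comm]; exact Submodule.smul_mem _ c hx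

theorem adjoin_a_le_normalOrderedSpan {x : CAR H}
    (hx : x ∈ StarAlgebra.adjoin ℂ (Set.range (a : H → CAR H))) : x ∈ normalOrderedSpan H := by
  -- Closure of the span under products is not directly visible. Its left multipliers do form an
  -- algebra, which contains the generators and their adjoints; multiplying `1`, the empty monomial,
  -- then gives the claim.
  have key : ∀ y ∈ normalOrderedSpan H, x * y ∈ normalOrderedSpan H := by
    change x ∈ Algebra.adjoin ℂ _ at hx
    induction hx using Algebra.adjoin_induction with
    | mem x hx =>
      intro y hy
      rcases hx with ⟨f, rfl⟩ | ⟨f, hf⟩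
      · exact a_mul_mem f hy
      · rw [← star_star x, ← hf]
        exact star_a_mul_mem f hy
    | algebraMap r =>
      intro y hy
      rw [← Algebra.smul_def]
      exact Submodule.smul_mem _ r hy
    | add x y _ _ hx hy =>
      intro z hz
      rw [add_mul]
      exact add_mem (hx z hz) (hy z hz)
    | mul x y _ _ hx hy =>
      intro z hz
      rw [mul_assoc]
      exact hx _ (hy z hz)
  have h1 : (1 : CAR H) ∈ normalOrderedSpan H := by
    have := monomial_mem_normalOrderedSpan (Fin.elim0 : Fin 0 → H) (Fin.elim0 : Fin 0 → H)
    simpa [monomial] using this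
  simpa using key 1 h1

theorem dense_normalOrderedSpan : Dense (normalOrderedSpan H : Set (CAR H)) := by
  have h : Dense (StarAlgebra.adjoin ℂ (Set.range (a : H → CAR H)) : Set (CAR H)) := by
    intro x
    rw [closure_subtype]
    have e : Subtype.val '' (StarAlgebra.adjoin ℂ (Set.range (a : H → CAR H)) : Set (CAR H))
        = (StarAlgebra.adjoin ℂ (Set.range (annProd (H := H))) : Set (CARProduct H)) := by
      have e1 := StarAlgHom.map_adjoin (carSubalgebra H).subtype (Set.range (a : H → CAR H))
      rw [← Set.range_comp] at e1
      exact congrArg (fun S : StarSubalgebra ℂ (CARProduct H) => (S : Set (CARProduct H))) e1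
    rw [e]
    exact x.2
  exact h.mono fun x hx => adjoin_a_le_normalOrderedSpan hx

/-! ### Gauge averages -/

theorem norm_bogoliubovHom_le (U : H ≃ₗᵢ[ℂ] H) (x : CAR H) : ‖bogoliubovHom U x‖ ≤ ‖x‖ :=
  NonUnitalStarAlgHom.norm_apply_le (bogoliubovHom U) x

theorem continuous_bogoliubovHom (U : H ≃ₗᵢ[ℂ] H) : Continuous (bogoliubovHom U) :=
  AddMonoidHomClass.continuous_of_bound (bogoliubovHom U) 1 fun x => by
    rw [one_mul]
    exact norm_bogoliubovHom_le U x

theorem isClosed_gicar : IsClosed (gicar H : Set (CAR H)) := by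
  have e : (gicar H : Set (CAR H)) = ⋂ z : Circle, {x | bogoliubovHom (phase z) x = x} := by
    ext x
    simp [mem_gicar]
  rw [e]
  exact isClosed_iInter fun z => isClosed_eq (continuous_bogoliubovHom _) continuous_id

theorem bogoliubovHom_phase_monomial (z : Circle) {n m : ℕ} (h : Fin n → H) (k : Fin m → H) :
    bogoliubovHom (phase z) (monomial h k) = ((z : ℂ) ^ n * star (z : ℂ) ^ m) • monomial h k := by
  rw [bogoliubovHom_monomial]
  have e : ∀ {l : ℕ} (f : Fin l → H), (phase z : H ≃ₗᵢ[ℂ] H) ∘ f = fun i => (z : ℂ) • f i :=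
    fun _ => rfl
  simp only [monomial, e, a_smul, star_smul, star_star, prod_ofFn_smul, smul_mul_smul_comm]

set_option synthInstance.maxHeartbeats 200000 in
/-- The average of `x` over the gauge transformations by the powers of `z` below `N`. -/
noncomputable def gaugeAverage (z : Circle) (N : ℕ) : CAR H →ₗ[ℂ] CAR H :=
  (N : ℂ)⁻¹ • ∑ j ∈ Finset.range N, (bogoliubovHom (phase (z ^ j))).toAlgHom.toLinearMap

theorem gaugeAverage_apply (z : Circle) (N : ℕ) (x : CAR H) : gaugeAverage z N x
    = (N : ℂ)⁻¹ • ∑ j ∈ Finset.range N, bogoliubovHom (phase (z ^ j)) x := by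
  simp [gaugeAverage]

set_option synthInstance.maxHeartbeats 200000 in
theorem gaugeAverage_of_mem_gicar (z : Circle) {N : ℕ} (hN : N ≠ 0) {x : CAR H}
    (hx : x ∈ gicar H) : gaugeAverage z N x = x := by
  rw [gaugeAverage_apply, Finset.sum_congr rfl fun j _ => mem_gicar.1 hx (z ^ j)]
  rw [Finset.sum_const, Finset.card_range, ← Nat.cast_smul_eq_nsmul ℂ, smul_smul,
    inv_mul_cancel₀ (Nat.cast_ne_zero.2 hN), one_smul]

theorem norm_gaugeAverage_le (z : Circle) {N : ℕ} (hN : N ≠ 0) (x : CAR H) :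
    ‖gaugeAverage z N x‖ ≤ ‖x‖ := by
  have hN' : (0 : ℝ) < N := Nat.cast_pos.2 (Nat.pos_of_ne_zero hN)
  rw [gaugeAverage_apply, norm_smul, norm_inv, Complex.norm_natCast, inv_mul_le_iff₀ hN']
  refine (norm_sum_le_of_le _ fun j _ => norm_bogoliubovHom_le (phase (z ^ j)) x).trans ?_
  simp

/-- The summands form a geometric series whose ratio `w = z^{n-m}` is an `N`-th root of unity,
nontrivial since `n` and `m` are distinct and below `N`. Finite averages over roots of unity thus do
the work of integration over the circle. -/
theorem gaugeAverage_monomial_of_ne {z : Circle} {N : ℕ} (hz : IsPrimitiveRoot (z : ℂ) N)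
    {n m : ℕ} (hn : n < N) (hm : m < N) (hnm : n ≠ m) (h : Fin n → H) (k : Fin m → H) :
    gaugeAverage z N (monomial h k) = 0 := by
  set w : ℂ := (z : ℂ) ^ n * star (z : ℂ) ^ m with hw
  have hzz : star (z : ℂ) * z = 1 := by
    rw [mul_comm]; simp [Complex.mul_conj]
  have hw1 : w ≠ 1 := by
    intro h1
    refine hnm (hz.pow_inj hn hm ?_)
    have : w * (z : ℂ) ^ m = (z : ℂ) ^ n := by
      rw [hw, mul_assoc, ← mul_pow, hzz, one_pow, mul_one]
    rw [← this, h1, one_mul]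
  have hwN : w ^ N = 1 := by
    rw [hw, mul_pow, ← pow_mul, ← pow_mul, mul_comm n, mul_comm m, pow_mul, pow_mul, ← star_pow,
      hz.pow_eq_one, star_one, one_pow, one_pow, one_mul]
  have hsum : ∑ j ∈ Finset.range N, w ^ j = 0 := by
    have := geom_sum_mul w N
    rw [hwN, sub_self] at this
    exact (mul_eq_zero.1 this).resolve_right (sub_ne_zero.2 hw1)
  have e : ∀ j ∈ Finset.range N, bogoliubovHom (phase (z ^ j)) (monomial h k)
      = w ^ j • monomial h k := fun j _ => by
    rw [bogoliubovHom_phase_monomial]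
    congr 1
    rw [hw, Circle.coe_pow, star_pow]
    ring
  rw [gaugeAverage_apply, Finset.sum_congr rfl e, ← Finset.sum_smul, hsum, zero_smul, smul_zero]

theorem exists_circle_isPrimitiveRoot {N : ℕ} (hN : N ≠ 0) :
    ∃ z : Circle, IsPrimitiveRoot (z : ℂ) N := by
  have h := Complex.isPrimitiveRoot_exp N hN
  exact ⟨⟨_, mem_sphere_zero_iff_norm.2 (h.norm'_eq_one hN)⟩, h⟩

variable (H) in
/-- The span of the gauge-invariant monomials. -/
noncomputable def gicarMonomialSpan : Submodule ℂ (gicar H) :=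
  Submodule.span ℂ {x | ∃ (n : ℕ) (h k : Fin n → H), x = gicarMonomial h k}

/-- Only finitely many monomials occur, so averages of sufficiently large order remove every
unbalanced one and fix the rest. A threshold, instead of a single order, lets two summands be
treated together through a maximum. -/
theorem gaugeAverage_mem_gicarMonomialSpan {x : CAR H} (hx : x ∈ normalOrderedSpan H) :
    ∃ N₀ : ℕ, ∀ N ≥ N₀, ∀ z : Circle, IsPrimitiveRoot (z : ℂ) N →
      ∃ y ∈ gicarMonomialSpan H, gaugeAverage z N x = y := by
  induction hx using Submodule.span_induction with
  | mem x hx =>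
    obtain ⟨n, m, h, k, rfl⟩ := hx
    -- This bound puts both degrees below `N` and also makes `N` nonzero.
    refine ⟨n + m + 1, fun N hN z hz => ?_⟩
    by_cases hnm : n = m
    · subst hnm
      refine ⟨gicarMonomial h k, Submodule.subset_span ⟨n, h, k, rfl⟩, ?_⟩
      exact gaugeAverage_of_mem_gicar z (by omega) (monomial_mem_gicar h k)
    · exact ⟨0, zero_mem _,
        gaugeAverage_monomial_of_ne hz (by omega) (by omega) hnm h k⟩
  | zero => exact ⟨0, fun N _ z _ => ⟨0, zero_mem _, map_zero _⟩⟩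
  | add x y _ _ hx hy =>
    obtain ⟨N₁, h₁⟩ := hx
    obtain ⟨N₂, h₂⟩ := hy
    refine ⟨max N₁ N₂, fun N hN z hz => ?_⟩
    obtain ⟨u, hu, eu⟩ := h₁ N (le_of_max_le_left hN) z hz
    obtain ⟨v, hv, ev⟩ := h₂ N (le_of_max_le_right hN) z hz
    exact ⟨u + v, add_mem hu hv, by rw [map_add, eu, ev]; rfl⟩
  | smul c x _ hx =>
    obtain ⟨N₁, h₁⟩ := hx
    refine ⟨N₁, fun N hN z hz => ?_⟩
    obtain ⟨u, hu, eu⟩ := h₁ N hN z hz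
    exact ⟨c • u, Submodule.smul_mem _ c hu, by rw [map_smul, eu]; rfl⟩

/-- Approximate `x` by a normally ordered `y` in the full algebra and average. The average fixes
`x`, does not increase the distance, and carries `y` into the span of balanced monomials. -/
theorem dense_gicarMonomialSpan : Dense (gicarMonomialSpan H : Set (gicar H)) := by
  intro x
  rw [Metric.mem_closure_iff]
  intro ε hε
  obtain ⟨y, hxy, hy⟩ := Metric.dense_iff.1 (dense_normalOrderedSpan (H := H)) x ε hε
  obtain ⟨N₀, hN₀⟩ := gaugeAverage_mem_gicarMonomialSpan hy
  obtain ⟨z, hz⟩ := exists_circle_isPrimitiveRoot (Nat.succ_ne_zero N₀)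
  obtain ⟨w, hw, e⟩ := hN₀ (N₀ + 1) (Nat.le_succ N₀) z hz
  refine ⟨w, hw, ?_⟩
  have h1 := norm_gaugeAverage_le z (Nat.succ_ne_zero N₀) ((x : CAR H) - y)
  rw [map_sub, gaugeAverage_of_mem_gicar z (Nat.succ_ne_zero N₀) x.2, e] at h1
  rw [Metric.mem_ball, dist_comm, dist_eq_norm] at hxy
  rw [Subtype.dist_eq, dist_eq_norm]
  exact lt_of_le_of_lt h1 hxy

end Algebra

section Implementation

variable {H : Type u} [NormedAddCommGroup H] [InnerProductSpace ℂ H]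
  {E : Type*} [NormedAddCommGroup E] [InnerProductSpace ℂ E] [CompleteSpace E]

/-! ### Representations of the GICAR algebra -/

/-- The fixed-point algebra is closed, hence a `C*`-algebra, and `*`-homomorphisms between
`C*`-algebras are contractive. -/
theorem norm_rep_apply_le (ρ : gicar H →⋆ₐ[ℂ] (E →L[ℂ] E)) (Ω : E) (x : gicar H) :
    ‖ρ x Ω‖ ≤ ‖Ω‖ * ‖x‖ := by
  have : IsClosed (gicar H : Set (CAR H)) := isClosed_gicar
  let _ : CStarAlgebra (gicar H) := StarSubalgebra.cstarAlgebra (gicar H)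
  have h : ‖ρ x‖ ≤ ‖x‖ := NonUnitalStarAlgHom.norm_apply_le ρ x
  rw [mul_comm]
  exact ((ρ x).le_opNorm Ω).trans (mul_le_mul_of_nonneg_right h (norm_nonneg Ω))

/-- The map `x ↦ ρ(x) Ω`. -/
noncomputable def orbitMap (ρ : gicar H →⋆ₐ[ℂ] (E →L[ℂ] E)) (Ω : E) : gicar H →L[ℂ] E :=
  LinearMap.mkContinuous
    { toFun := fun x => ρ x Ω
      map_add' := fun x y => by rw [map_add, add_apply]
      map_smul' := fun c x => by rw [map_smul, smul_apply, RingHom.id_apply] } ‖Ω‖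
    (norm_rep_apply_le ρ Ω)

theorem orbitMap_apply (ρ : gicar H →⋆ₐ[ℂ] (E →L[ℂ] E)) (Ω : E) (x : gicar H) :
    orbitMap ρ Ω x = ρ x Ω := rfl

theorem bogoliubov_gicarMonomial (W : H ≃ₗᵢ[ℂ] H) {n : ℕ} (h k : Fin n → H) :
    bogoliubov W (gicarMonomial h k) = gicarMonomial (W ∘ h) (W ∘ k) :=
  Subtype.ext (bogoliubovHom_monomial W h k)

theorem continuous_gicarMonomial {X : Type*} [TopologicalSpace X] {n : ℕ} {h k : X → Fin n → H}
    (hh : Continuous h) (hk : Continuous k) : Continuous fun x => gicarMonomial (h x) (k x) :=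
  (continuous_monomial hh hk).subtype_mk _

/-- The product rule gives a derivative in the full CAR algebra, while `L` is defined only on the
gauge-invariant part. The difference quotients lie in that closed subspace, so their limit does too
and `L` can be applied to it. -/
theorem differentiableAt_clm_gicarMonomial {F : Type*} [NormedAddCommGroup F]
    [InnerProductSpace ℂ F] (L : gicar H →L[ℂ] F) {t : ℝ} {n : ℕ}
    {h k : Fin n → ℝ → H} (hh : ∀ i, DifferentiableAt ℝ (h i) t)
    (hk : ∀ i, DifferentiableAt ℝ (k i) t) :
    DifferentiableAt ℝ (fun x => L (gicarMonomial (fun i => h i x) (fun i => k i x))) t := by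
  have hd := (differentiableAt_monomial hh hk).hasDerivAt
  set d := deriv (fun x => monomial (fun i => h i x) (fun i => k i x)) t
  rw [hasDerivAt_iff_tendsto_slope] at hd
  let q : ℝ → gicar H := fun s => (((s - t)⁻¹ : ℝ) : ℂ) •
    (gicarMonomial (fun i => h i s) (fun i => k i s)
      - gicarMonomial (fun i => h i t) (fun i => k i t))
  have hq : Filter.Tendsto (fun s => (q s : CAR H)) (nhdsWithin t {t}ᶜ) (nhds d) := hd
  have hmem : d ∈ gicar H :=
    isClosed_gicar.mem_of_tendsto hq (Filter.Eventually.of_forall fun s => (q s).2)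
  have hq' : Filter.Tendsto q (nhdsWithin t {t}ᶜ) (nhds ⟨d, hmem⟩) := tendsto_subtype_rng.2 hq
  refine HasDerivAt.differentiableAt (f' := L ⟨d, hmem⟩) ?_
  rw [hasDerivAt_iff_tendsto_slope]
  refine ((L.continuous.tendsto _).comp hq').congr fun s => ?_
  rw [Function.comp_apply, map_smul]
  exact congrArg (fun v => (((s - t)⁻¹ : ℝ) : ℂ) • v) (map_sub L _ _)

theorem continuous_bogoliubov (W : H ≃ₗᵢ[ℂ] H) : Continuous (bogoliubov W) :=
  ((continuous_bogoliubovHom W).comp continuous_subtype_val).subtype_mk _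

theorem gicarMonomial_mem_monomialSpan (ρ : gicar H →⋆ₐ[ℂ] (E →L[ℂ] E)) (Ω : E)
    {V : Submodule ℂ H} {n : ℕ} {h k : Fin n → H} (hh : ∀ i, h i ∈ V) (hk : ∀ i, k i ∈ V) :
    ρ (gicarMonomial h k) Ω ∈ monomialSpan ρ Ω V :=
  Submodule.subset_span ⟨n, h, k, hh, hk, rfl⟩

/-- Three approximations are chained: vectors of `H` by vectors of `V` inside a monomial, elements
of the algebra by combinations of balanced monomials, and vectors of `E` by the cyclic orbit. -/
theorem dense_monomialSpan {ρ : gicar H →⋆ₐ[ℂ] (E →L[ℂ] E)} {Ω : E}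
    (hcyc : Dense (Set.range fun x => ρ x Ω)) {V : Submodule ℂ H} (hV : Dense (V : Set H)) :
    Dense (monomialSpan ρ Ω V : Set E) := by
  set S := (monomialSpan ρ Ω V).topologicalClosure with hS
  have h1 : ∀ (n : ℕ) (p : (Fin n → H) × (Fin n → H)), orbitMap ρ Ω (gicarMonomial p.1 p.2) ∈ S := by
    intro n p
    have hd : Dense (Set.univ.pi fun _ : Fin n => (V : Set H)) := dense_pi _ fun _ _ => hV
    have hc : Continuous fun p : (Fin n → H) × (Fin n → H) =>
        orbitMap ρ Ω (gicarMonomial p.1 p.2) :=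
      (orbitMap ρ Ω).continuous.comp (continuous_gicarMonomial continuous_fst continuous_snd)
    have hsub : closure ((Set.univ.pi fun _ : Fin n => (V : Set H)) ×ˢ
          (Set.univ.pi fun _ : Fin n => (V : Set H)))
        ⊆ (fun p : (Fin n → H) × (Fin n → H) => orbitMap ρ Ω (gicarMonomial p.1 p.2)) ⁻¹'
          closure (monomialSpan ρ Ω V : Set E) :=
      closure_minimal (fun q hq => subset_closure (gicarMonomial_mem_monomialSpan ρ Ω
        (fun i => hq.1 i trivial) (fun i => hq.2 i trivial))) (isClosed_closure.preimage hc)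
    exact hsub ((hd.prod hd) p)
  have h2 : ∀ x : gicar H, orbitMap ρ Ω x ∈ S := by
    have hle : gicarMonomialSpan H ≤ S.comap (orbitMap ρ Ω : gicar H →ₗ[ℂ] E) := by
      refine Submodule.span_le.2 ?_
      rintro _ ⟨n, h, k, rfl⟩
      exact h1 n (h, k)
    have hcl : IsClosed ((orbitMap ρ Ω) ⁻¹' (S : Set E)) :=
      (Submodule.isClosed_topologicalClosure _).preimage (orbitMap ρ Ω).continuous
    exact fun x => hcl.closure_subset_iff.2 hle (dense_gicarMonomialSpan x)
  have h3 : Dense (S : Set E) := hcyc.mono (by rintro _ ⟨x, rfl⟩; exact h2 x)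
  rw [hS, Submodule.topologicalClosure_coe] at h3
  exact dense_closure.1 h3

/-- Equality of norms makes `ρ(x)Ω ↦ ρ(γ(x))Ω` well defined and isometric on the dense orbit;
completeness of `E` allows the extension. -/
theorem IsGNSTriple.exists_linearIsometry {A : Type*} [Ring A] [StarRing A] [Algebra ℂ A]
    {φ : A →ₗ[ℂ] ℂ} {ρ : A →⋆ₐ[ℂ] (E →L[ℂ] E)} {Ω : E} (hρ : IsGNSTriple φ ρ Ω) (γ : A →⋆ₐ[ℂ] A)
    (hγ : ∀ x, ‖ρ (γ x) Ω‖ = ‖ρ x Ω‖) : ∃ G : E →ₗᵢ[ℂ] E, ∀ x, G (ρ x Ω) = ρ (γ x) Ω := by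
  let e : A →ₗ[ℂ] E :=
    { toFun := fun x => ρ x Ω
      map_add' := fun x y => by rw [map_add, add_apply]
      map_smul' := fun c x => by rw [map_smul, smul_apply, RingHom.id_apply] }
  let f : A →ₗ[ℂ] E :=
    { toFun := fun x => ρ (γ x) Ω
      map_add' := fun x y => by rw [map_add, map_add, add_apply]
      map_smul' := fun c x => by rw [map_smul, map_smul, smul_apply, RingHom.id_apply] }
  have hd' : DenseRange e := hρ.cyclic
  have hG : ∀ x, f.extendOfNorm e (e x) = f x :=
    LinearMap.extendOfNorm_eq hd' ⟨1, fun x => by rw [one_mul]; exact (hγ x).le⟩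
  refine ⟨⟨(f.extendOfNorm e : E →ₗ[ℂ] E), fun v => ?_⟩, hG⟩
  refine hd'.induction_on (p := fun v => ‖f.extendOfNorm e v‖ = ‖v‖) v
    (isClosed_eq (by fun_prop) (by fun_prop)) fun x => ?_
  rw [hG]
  exact hγ x

/-! ### Invariance of the state and the implementing group -/

section Invariance

variable [CompleteSpace H] {K : H →L[ℂ] H} {hK₀ : 0 ≤ K} {hK₁ : K ≤ 1}
  {ρ : gicar H →⋆ₐ[ℂ] (E →L[ℂ] E)} {Ω : E}

theorem gicarState_gicarMonomial {n : ℕ} (h k : Fin n → H) :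
    gicarState K hK₀ hK₁ (gicarMonomial h k)
      = Matrix.det (Matrix.of fun i j => (inner ℂ (k j) (K (h (Fin.rev i))) : ℂ)) := by
  -- The determinant formula lists the creation operators in reverse order, so it is applied to the
  -- reversed family; reversal is an involution.
  have := (quasiFreeState_spec K hK₀ hK₁).eq_det n (h ∘ Fin.rev) k
  have e : (h ∘ Fin.rev) ∘ Fin.rev = h := by
    ext i
    simp
  rw [e] at this
  exact this

/-- The quasi-free state is invariant under unitaries commuting with its symbol. -/
theorem gicarState_bogoliubov (hρ : IsGNSTriple (gicarState K hK₀ hK₁) ρ Ω) {W : H ≃ₗᵢ[ℂ] H}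
    (hW : ∀ x y, (inner ℂ (W x) (K (W y)) : ℂ) = inner ℂ x (K y)) (x : gicar H) :
    gicarState K hK₀ hK₁ (bogoliubov W x) = gicarState K hK₀ hK₁ x := by
  -- Continuity comes from writing the state as the vector functional `⟨Ω, ρ(x)Ω⟩`. Invariance then
  -- needs checking only on balanced monomials, where the entries of the determinant are preserved
  -- by `hW`.
  have hc : Continuous fun x => gicarState K hK₀ hK₁ x := by
    simp only [← hρ.inner_eq, ← orbitMap_apply]
    exact continuous_const.inner (orbitMap ρ Ω).continuous
  have hcl : IsClosed {x : gicar H | gicarState K hK₀ hK₁ (bogoliubov W x)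
      = gicarState K hK₀ hK₁ x} :=
    isClosed_eq (hc.comp (continuous_bogoliubov W)) hc
  refine hcl.closure_subset_iff.2 (fun y hy => ?_) (dense_gicarMonomialSpan x)
  rw [Set.mem_ofPred_eq]
  induction hy using Submodule.span_induction with
  | mem y hy =>
    obtain ⟨n, h, k, rfl⟩ := hy
    rw [bogoliubov_gicarMonomial, gicarState_gicarMonomial, gicarState_gicarMonomial]
    simp only [Function.comp_apply, hW]
  | zero => rw [map_zero]
  | add y z _ _ hy hz => rw [map_add, map_add, map_add, hy, hz]
  | smul c y _ hy => rw [map_smul, map_smul, map_smul, hy]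

/-- The squared norm of `ρ(y)Ω` is the state at `y* y`, and `γ_W` is a `*`-homomorphism preserving
the state. -/
theorem norm_rep_bogoliubov_apply (hρ : IsGNSTriple (gicarState K hK₀ hK₁) ρ Ω) {W : H ≃ₗᵢ[ℂ] H}
    (hW : ∀ x y, (inner ℂ (W x) (K (W y)) : ℂ) = inner ℂ x (K y)) (x : gicar H) :
    ‖ρ (bogoliubov W x) Ω‖ = ‖ρ x Ω‖ := by
  have key : ∀ y : gicar H, (inner ℂ (ρ y Ω) (ρ y Ω) : ℂ) = gicarState K hK₀ hK₁ (star y * y) := by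
    intro y
    rw [← hρ.inner_eq, map_mul, map_star, ContinuousLinearMap.star_eq_adjoint,
      mul_apply_eq_comp, ContinuousLinearMap.adjoint_inner_right]
  have h : (inner ℂ (ρ (bogoliubov W x) Ω) (ρ (bogoliubov W x) Ω) : ℂ)
      = inner ℂ (ρ x Ω) (ρ x Ω) := by
    rw [key, key, ← map_star, ← map_mul, gicarState_bogoliubov hρ hW]
  rw [inner_self_eq_norm_sq_to_K, inner_self_eq_norm_sq_to_K] at h
  have h' : ‖ρ (bogoliubov W x) Ω‖ ^ 2 = ‖ρ x Ω‖ ^ 2 := by exact_mod_cast h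
  exact (sq_eq_sq₀ (norm_nonneg _) (norm_nonneg _)).1 h'

/-- The implementing isometry of a unitary commuting with the symbol. -/
theorem exists_implementing_isometry (hρ : IsGNSTriple (gicarState K hK₀ hK₁) ρ Ω)
    {W : H ≃ₗᵢ[ℂ] H} (hW : ∀ x y, (inner ℂ (W x) (K (W y)) : ℂ) = inner ℂ x (K y)) :
    ∃ G : E →ₗᵢ[ℂ] E, ∀ x, G (ρ x Ω) = ρ (bogoliubov W x) Ω := by
  exact hρ.exists_linearIsometry (bogoliubov W) (norm_rep_bogoliubov_apply hρ hW)

/-- A unitary group commuting with the symbol is implemented by a unitary group. -/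
theorem exists_implements (hρ : IsGNSTriple (gicarState K hK₀ hK₁) ρ Ω) (U : UnitaryGroup H)
    (hU : ∀ t x y, (inner ℂ (U t x) (K (U t y)) : ℂ) = inner ℂ x (K y)) :
    ∃ Γ : UnitaryGroup E, Implements Γ U ρ Ω := by
  choose G hG using fun t => exists_implementing_isometry hρ (hU t)
  have hd : DenseRange fun x => ρ x Ω := hρ.cyclic
  have hadd : ∀ s t v, G (s + t) v = G s (G t v) := fun s t v => by
    refine hd.induction_on (p := fun v => G (s + t) v = G s (G t v)) v
      (isClosed_eq (G _).continuous ((G s).continuous.comp (G t).continuous)) fun x => ?_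
    rw [hG, hG, hG]
    have e : U (s + t) = (U t).trans (U s) := LinearIsometryEquiv.ext (U.map_add' s t)
    rw [e]
    rfl
  have hzero : ∀ v, G 0 v = v := fun v => by
    refine hd.induction_on (p := fun v => G 0 v = v) v
      (isClosed_eq (G _).continuous continuous_id) fun x => ?_
    rw [hG]
    have e : U 0 = LinearIsometryEquiv.refl ℂ H := LinearIsometryEquiv.ext U.map_zero'
    rw [e]
    rfl
  have hcont : ∀ v, Continuous fun t => G t v := fun v => by
    -- On a monomial vector the orbit in `t` only moves the one-particle vectors, so strong
    -- continuity of `U` is enough.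
    have hspan : ∀ w ∈ monomialSpan ρ Ω (⊤ : Submodule ℂ H), Continuous fun t => G t w := by
      intro w hw
      induction hw using Submodule.span_induction with
      | mem w hw =>
        obtain ⟨n, h, k, -, -, rfl⟩ := hw
        simp only [hG, bogoliubov_gicarMonomial]
        exact (orbitMap ρ Ω).continuous.comp (continuous_gicarMonomial
          (continuous_pi fun i => U.continuous' (h i)) (continuous_pi fun i => U.continuous' (k i)))
      | zero => simpa using continuous_const
      | add w w' _ _ hw hw' => simpa only [map_add] using hw.fun_add hw'
      | smul c w _ hw => simpa only [map_smul] using hw.fun_const_smul c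
    -- Every `G t` is an isometry, so approximating `v` by `w` approximates the whole orbit
    -- uniformly in `t`.
    refine continuous_of_uniform_approx_of_continuous fun u hu => ?_
    obtain ⟨ε, hε, hεu⟩ := Metric.mem_uniformity_dist.1 hu
    obtain ⟨w, hw, hwS⟩ :=
      Metric.dense_iff.1 (dense_monomialSpan hρ.cyclic (V := ⊤) dense_univ) v ε hε
    refine ⟨fun t => G t w, hspan w hwS, fun t => hεu ?_⟩
    rw [(G t).dist_map, dist_comm]
    exact hw
  -- Surjectivity comes from the group law: `G (-t) v` is a preimage of `v` under `G t`.
  refine ⟨⟨fun t => LinearIsometryEquiv.ofSurjective (G t) fun v => ⟨G (-t) v, ?_⟩, hzero, hadd,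
    hcont⟩, hG⟩
  rw [← hadd, add_neg_cancel, hzero]

end Invariance

/-! ### Uniqueness and the core -/

theorem implements_unique {ρ : gicar H →⋆ₐ[ℂ] (E →L[ℂ] E)} {Ω : E}
    (hcyc : Dense (Set.range fun x => ρ x Ω)) {U : UnitaryGroup H} {Γ Γ' : UnitaryGroup E}
    (h : Implements Γ U ρ Ω) (h' : Implements Γ' U ρ Ω) : Γ = Γ' := by
  refine UnitaryGroup.ext (funext fun t => LinearIsometryEquiv.ext fun v => ?_)
  refine DenseRange.induction_on (p := fun v => Γ t v = Γ' t v) hcyc v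
    (isClosed_eq (Γ t).continuous (Γ' t).continuous) fun x => ?_
  rw [h, h']

/-- `Γ t` carries a monomial vector to the one with all entries moved by `U t`. Invariance of `V`
therefore gives invariance of the span, and differentiability of the entries' orbits puts the span
in the domain. -/
theorem Implements.hasCore {ρ : gicar H →⋆ₐ[ℂ] (E →L[ℂ] E)} {Ω : E}
    (hcyc : Dense (Set.range fun x => ρ x Ω)) {U : UnitaryGroup H} {Γ : UnitaryGroup E}
    (hΓ : Implements Γ U ρ Ω) {V : Submodule ℂ H} (hV : Dense (V : Set H))
    (hdom : V ≤ U.generator.domain) (hinv : ∀ t : ℝ, ∀ v ∈ V, U t v ∈ V) :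
    Γ.generator.HasCore (monomialSpan ρ Ω V) := by
  refine Γ.hasCore_generator (dense_monomialSpan hcyc hV) ?_ fun t x hx => ?_
  · refine Submodule.span_le.2 ?_
    rintro _ ⟨n, h, k, hh, hk, rfl⟩
    change DifferentiableAt ℝ (fun t : ℝ => Γ t (ρ (gicarMonomial h k) Ω)) 0
    simp only [hΓ _ _, bogoliubov_gicarMonomial]
    exact differentiableAt_clm_gicarMonomial (orbitMap ρ Ω) (h := fun i s => U s (h i))
      (k := fun i s => U s (k i)) (fun i => hdom (hh i)) fun i => hdom (hk i)
  · induction hx using Submodule.span_induction with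
    | mem x hx =>
      obtain ⟨n, h, k, hh, hk, rfl⟩ := hx
      rw [hΓ, bogoliubov_gicarMonomial]
      exact gicarMonomial_mem_monomialSpan ρ Ω (fun i => hinv t _ (hh i)) fun i => hinv t _ (hk i)
    | zero => simp
    | add x y _ _ hx hy => rw [map_add]; exact add_mem hx hy
    | smul c x _ hx => rw [map_smul]; exact Submodule.smul_mem _ c hx

end Implementation

end GICAR

theorem proposition4p1 {H : Type*} [NormedAddCommGroup H] [InnerProductSpace ℂ H] [CompleteSpace H]
    (K : H →L[ℂ] H) (hK₀ : 0 ≤ K) (hK₁ : K ≤ 1)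
    (A : H →ₗ.[ℂ] H) (hA : IsSelfAdjoint A) (hAK : GICAR.Commutes A K)
    (U : GICAR.UnitaryGroup H) (hU : U.generator = A)
    {E : Type*} [NormedAddCommGroup E] [InnerProductSpace ℂ E] [CompleteSpace E]
    (ρ : GICAR.gicar H →⋆ₐ[ℂ] (E →L[ℂ] E)) (Ω : E)
    (hρ : GICAR.IsGNSTriple (GICAR.gicarState K hK₀ hK₁) ρ Ω) :
    (∃! Γ : GICAR.UnitaryGroup E, GICAR.Implements Γ U ρ Ω) ∧
    ∀ Γ : GICAR.UnitaryGroup E, GICAR.Implements Γ U ρ Ω →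
      ∀ V : Submodule ℂ H, Dense (V : Set H) → V ≤ A.domain → (∀ t : ℝ, ∀ v ∈ V, U t v ∈ V) →
        Γ.generator.HasCore (GICAR.monomialSpan ρ Ω V) := by
  subst hU
  refine ⟨?_, fun Γ hΓ V hV hdom hinv => hΓ.hasCore hρ.cyclic hV hdom hinv⟩
  -- Self-adjointness supplies a dense domain, from which preservation of the form of `K` extends to
  -- all of `H`.
  obtain ⟨Γ, hΓ⟩ := GICAR.exists_implements hρ U
    (U.inner_apply_apply_of_commutes hA.dense_domain hAK)
  exact ⟨Γ, hΓ, fun Γ' hΓ' => GICAR.implements_unique hρ.cyclic hΓ' hΓ⟩
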